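/- Let $K\subseteq\mathbb R^{n}\times\mathbb R^{m}$ be a compact \emph{regular partially convex} set: with $Y=\pi_Y(K)\subseteq\mathbb R^m$ its projection, for every $y\in Y$ the slice $K_y=\{x\in\mathbb R^n\mid (x,y)\in K\}$ is convex with nonempty interior, and the set-valued map $y\mapsto \operatorname{int}(K_y)$ is lower hemicontinuous (LHC) on $Y$. Let $A=\mathcal C_{\mathrm{aff}}(K)$ be the real vector space of continuous functions $f:K\to\mathbb R$ such that $f(\cdot,y)$ is affine on $K_y$ for every $y\in Y$, with the pointwise order, the positive cone $A^+$, the unit $u=1$ and the supremum norm. Then $A$ is a free order unit module of type $(n,m)$ over $\mathcal C(Y)=\mathcal C(Y,\mathbb R)$, with basis $e_0=1,\ e_1=x_1,\dots,e_n=x_n$. That is, $Y$ is compact and the following hold. \begin{enumerate} \item $A$ is an Archimedean order unit (AOU) space with order unit $u$, and its order unit norm is the supremum norm. \item The multiplicative domain $\mathcal M_A=\{z\in A\mid z\cdot a\in A\text{ for all }a\in A\}$ (for the pointwise product in $\mathcal C(K)$), with the norm of $A$, is a real commutative $C^*$-algebra, finitely generated as such, and $g\mapsto g\circ\pi_Y$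 is an isometric algebra isomorphism $\mathcal C(Y)\to\mathcal M_A$, by which we identify the two. Pointwise multiplication makes $A$ an $\mathcal M_A$-module on which the unit $1_Y$ of $\mathcal C(Y)$ acts as the identity. \item $A$ is a free $\mathcal M_A$-module with basis $e_0,\dots,e_n$: every $a\in A$ is $\sum_{i=0}^n c_ie_i$ with unique $c_i\in\mathcal C(Y)$. \item $u=1_Y\cdot e_0$. \item For $y\in Y$ let $J_y$ be the smallest norm-closed linear subspace of $A$ that is an order ideal ($0\le p\le q$, $q\in J_y$ imply $p\in J_y$) and contains all $g\in\mathcal M_A$ with $g(y)=0$. Let $A_y=A/J_y$, let $[a]_y\in A_y$ be the class of $a\in A$, and let $A_y^+=\{[a]_y\mid a\in A^+\}$. Then $A_y$ is an AOU space of dimension $n+1$ with order unit $[u]_y$, and $A^+=\{a\in A\mid [a]_y\in A_y^+\text{ for all }y\in Y\}$. Moreover, restriction $[f]_y\mapsto f(\cdot,y)$ is a well-defined unital order isomorphism from $A_y$ onto $\mathrm{Aff}(K_y)$, the continuous affine functions on $K_y$ with the pointwise order. \item Let $\|\cdot\|_y$ be the order unit norm of $A_y$. For $y_k\to y_0$ in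 $Y$, say that $v_k\in A_{y_k}$ converge to $v_0\in A_{y_0}$ if there is an $a\in A$ with $[a]_{y_0}=v_0$ and $\|v_k-[a]_{y_k}\|_{y_k}\to0$. Then $y\mapsto A_y^+$ is LHC: if $y_k\to y_0$ and $v_0\in A_{y_0}^+$, there are $v_k\in A_{y_k}^+$ that converge to $v_0$. And for every $r>0$ the map $y\mapsto \{v\in A_y^+\mid \|v\|_y\le r\}$ is upper hemicontinuous: if $y_k\to y_0$ and $v_k\in A_{y_k}^+$, $\|v_k\|_{y_k}\le r$, then a subsequence of $(v_k)$ converges to some $v_0\in A_{y_0}^+$ with $\|v_0\|_{y_0}\le r$. \item The linear isomorphism $\Psi:A\to\mathcal C(Y)^{n+1}$, $\sum_i c_ie_i\mapsto(c_0,\dots,c_n)$, is a homeomorphism for the norm topologies: $\|a^{(k)}-a\|\to0$ if and only if $\sup_{y\in Y}|c_i^{(k)}(y)-c_i(y)|\to0$ for every $i$. \end{enumerate} -/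

import Mathlib

open Set Filter Topology TopologicalSpace

noncomputable section

/-! ## Archimedean order unit spaces, given by their positive cone and order unit -/

/-- The real vector space `V`, ordered by `v ≤ w ↔ w - v ∈ C`, is an Archimedean order unit space
with order unit `u`. -/
structure IsAOUSpace {V : Type*} [AddCommGroup V] [Module ℝ V] (C : PointedCone ℝ V) (u : V) :
    Prop where
  /-- the cone is proper, so that the order is antisymmetric -/
  proper : ∀ v : V, v ∈ C → -v ∈ C → v = 0
  /-- `u` is an order unit -/
  order_unit : ∀ v : V, ∃ r : ℝ, 0 < r ∧ r • u - v ∈ C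
  /-- `u` is Archimedean -/
  archimedean : ∀ v : V, (∀ r : ℝ, 0 < r → r • u + v ∈ C) → v ∈ C

/-- The order unit norm `‖v‖ = inf {r > 0 | -r u ≤ v ≤ r u}`. -/
def orderUnitNorm {V : Type*} [AddCommGroup V] [Module ℝ V] (C : PointedCone ℝ V) (u : V)
    (v : V) : ℝ :=
  sInf {r : ℝ | 0 < r ∧ v + r • u ∈ C ∧ r • u - v ∈ C}

/-- `J` is an order ideal: `0 ≤ p ≤ q` and `q ∈ J` imply `p ∈ J`. -/
def IsOrderIdeal {V : Type*} [AddCommGroup V] [Module ℝ V] (C : PointedCone ℝ V)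
    (J : Submodule ℝ V) : Prop :=
  ∀ p q : V, q ∈ J → p ∈ C → q - p ∈ C → p ∈ J

/-- `J` is closed in the order unit norm. -/
def IsOrderUnitClosed {V : Type*} [AddCommGroup V] [Module ℝ V] (C : PointedCone ℝ V) (u : V)
    (J : Submodule ℝ V) : Prop :=
  ∀ v : V, (∀ ε : ℝ, 0 < ε → ∃ w ∈ J, orderUnitNorm C u (v - w) < ε) → v ∈ J

/-- The closed order ideal generated by a set `s`. -/
def closedOrderIdeal {V : Type*} [AddCommGroup V] [Module ℝ V] (C : PointedCone ℝ V) (u : V)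
    (s : Set V) : Submodule ℝ V :=
  sInf {J | IsOrderIdeal C J ∧ IsOrderUnitClosed C u J ∧ s ⊆ J}

/-! ## Multiplicative domain -/

/-- A unital order embedding `ι` of the ordered space `(A, C, u)` into the algebra `C(X)`. It is
what gives a meaning to the product `z · a` of two elements of `A`: the product is the pointwise
one in `C(X)`. -/
structure FunctionRep {A : Type*} [AddCommGroup A] [Module ℝ A] (C : PointedCone ℝ A) (u : A)
    (X : Type*) [TopologicalSpace X] where
  /-- the embedding -/
  ι : A →ₗ[ℝ] C(X, ℝ)
  injective : Function.Injective ι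
  map_unit : ι u = 1
  mem_cone_iff : ∀ a : A, a ∈ C ↔ ∀ x : X, 0 ≤ ι a x

namespace FunctionRep

variable {A : Type*} [AddCommGroup A] [Module ℝ A] {C : PointedCone ℝ A} {u : A}
  {X : Type*} [TopologicalSpace X]

/-- The multiplicative domain `M_A = {z ∈ A | ∀ a ∈ A, z · a ∈ A}`. -/
def multDomain (R : FunctionRep C u X) : Set A :=
  {z | ∀ a : A, ∃ b : A, R.ι b = R.ι z * R.ι a}

/-- The multiplicative domain, as a subalgebra of `C(X)`. -/
def multAlg (R : FunctionRep C u X) : Subalgebra ℝ C(X, ℝ) where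
  carrier := R.ι '' R.multDomain
  mul_mem' := by
    rintro _ _ ⟨z, hz, rfl⟩ ⟨w, hw, rfl⟩
    obtain ⟨b, hb⟩ := hz w
    refine ⟨b, fun a => ?_, hb⟩
    obtain ⟨c, hc⟩ := hw a
    obtain ⟨d, hd⟩ := hz c
    exact ⟨d, by rw [hd, hc, hb, mul_assoc]⟩
  add_mem' := by
    rintro _ _ ⟨z, hz, rfl⟩ ⟨w, hw, rfl⟩
    refine ⟨z + w, fun a => ?_, map_add _ _ _⟩
    obtain ⟨b, hb⟩ := hz a
    obtain ⟨c, hc⟩ := hw a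
    exact ⟨b + c, by rw [map_add, map_add, hb, hc, add_mul]⟩
  algebraMap_mem' := by
    intro r
    have h : R.ι (r • u) = algebraMap ℝ C(X, ℝ) r := by
      rw [map_smul, R.map_unit, Algebra.algebraMap_eq_smul_one]
    refine ⟨r • u, fun a => ⟨r • a, ?_⟩, h⟩
    rw [h, map_smul, Algebra.smul_def]

theorem exists_smul (R : FunctionRep C u X) (g : R.multAlg) (a : A) :
    ∃ b : A, R.ι b = (g : C(X, ℝ)) * R.ι a := by
  obtain ⟨z, hz, h⟩ := g.2
  rw [← h]
  exact hz a

instance (R : FunctionRep C u X) : SMul R.multAlg A :=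
  ⟨fun g a => Classical.choose (R.exists_smul g a)⟩

theorem ι_smul (R : FunctionRep C u X) (g : R.multAlg) (a : A) :
    R.ι (g • a) = (g : C(X, ℝ)) * R.ι a :=
  Classical.choose_spec (R.exists_smul g a)

/-- `A` is a module over its multiplicative domain, by pointwise multiplication in `C(X)`. -/
instance (R : FunctionRep C u X) : Module R.multAlg A where
  one_smul a := R.injective (by rw [ι_smul]; simp)
  mul_smul g h a := R.injective (by simp only [ι_smul]; simp [mul_assoc])
  smul_zero g := R.injective (by simp [ι_smul])
  smul_add g a b := R.injective (by simp [ι_smul, mul_add])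
  add_smul g h a := R.injective (by simp [ι_smul, add_mul])
  zero_smul a := R.injective (by simp [ι_smul])

/-! ## Fibers -/

variable {m : ℕ} {Y : Compacts (Fin m → ℝ)}

/-- The maximal ideal `I_y` of the multiplicative domain, as a subset of `A`; the element of `A`
that corresponds to `g` in the multiplicative domain is `g • u`. -/
def maxIdeal (R : FunctionRep C u X) (φ : R.multAlg ≃ₐ[ℝ] C(Y, ℝ)) (y : Y) : Set A :=
  {z | ∃ g : R.multAlg, φ g y = 0 ∧ z = g • u}

/-- The closed order ideal `J_y` generated by `I_y`. -/
def fiberIdeal (R : FunctionRep C u X) (φ : R.multAlg ≃ₐ[ℝ] C(Y, ℝ)) (y : Y) : Submodule ℝ A :=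
  closedOrderIdeal C u (R.maxIdeal φ y)

/-- The fiber `A_y = A / J_y`. -/
abbrev Fiber (R : FunctionRep C u X) (φ : R.multAlg ≃ₐ[ℝ] C(Y, ℝ)) (y : Y) : Type _ :=
  A ⧸ R.fiberIdeal φ y

/-- The class `[a]_y` of `a` in the fiber `A_y`. -/
def toFiber (R : FunctionRep C u X) (φ : R.multAlg ≃ₐ[ℝ] C(Y, ℝ)) (y : Y) : A →ₗ[ℝ] R.Fiber φ y :=
  (R.fiberIdeal φ y).mkQ

/-- The quotient cone `(A_y)⁺`: the classes of the positive elements of `A`. -/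
def fiberCone (R : FunctionRep C u X) (φ : R.multAlg ≃ₐ[ℝ] C(Y, ℝ)) (y : Y) :
    PointedCone ℝ (R.Fiber φ y) :=
  C.map (R.toFiber φ y)

/-- The order unit norm of the fiber `A_y`. -/
def fiberNorm (R : FunctionRep C u X) (φ : R.multAlg ≃ₐ[ℝ] C(Y, ℝ)) (y : Y) (v : R.Fiber φ y) : ℝ :=
  orderUnitNorm (R.fiberCone φ y) (R.toFiber φ y u) v

/-- Convergence of `v k ∈ A_{y k}` to `v₀ ∈ A_{y₀}`, for a sequence `y k → y₀`: there is a global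
section `a ∈ A` with `[a]_{y₀} = v₀` and `‖v k - [a]_{y k}‖ → 0`. -/
def FiberTendsto (R : FunctionRep C u X) (φ : R.multAlg ≃ₐ[ℝ] C(Y, ℝ)) (y : ℕ → Y)
    (v : ∀ k, R.Fiber φ (y k)) (y₀ : Y) (v₀ : R.Fiber φ y₀) : Prop :=
  ∃ a : A, R.toFiber φ y₀ a = v₀ ∧
    Tendsto (fun k => R.fiberNorm φ (y k) (v k - R.toFiber φ (y k) a)) atTop (𝓝 0)

/-- Lower hemicontinuity of the set-valued map `y ↦ S y ⊆ A_y`. -/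
def FiberLHC (R : FunctionRep C u X) (φ : R.multAlg ≃ₐ[ℝ] C(Y, ℝ))
    (S : ∀ y : Y, Set (R.Fiber φ y)) : Prop :=
  ∀ (y : ℕ → Y) (y₀ : Y), Tendsto y atTop (𝓝 y₀) → ∀ v₀ ∈ S y₀,
    ∃ v : ∀ k, R.Fiber φ (y k), (∀ k, v k ∈ S (y k)) ∧ R.FiberTendsto φ y v y₀ v₀

/-- Upper hemicontinuity of the (compact-valued) set-valued map `y ↦ S y ⊆ A_y`: if `y k → y₀`, every
sequence `v k ∈ S (y k)` has a subsequence that converges to an element of `S y₀`. -/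
def FiberUHC (R : FunctionRep C u X) (φ : R.multAlg ≃ₐ[ℝ] C(Y, ℝ))
    (S : ∀ y : Y, Set (R.Fiber φ y)) : Prop :=
  ∀ (y : ℕ → Y) (y₀ : Y), Tendsto y atTop (𝓝 y₀) →
    ∀ v : ∀ k, R.Fiber φ (y k), (∀ k, v k ∈ S (y k)) →
      ∃ v₀ ∈ S y₀, ∃ s : ℕ → ℕ, StrictMono s ∧
        R.FiberTendsto φ (fun k => y (s k)) (fun k => v (s k)) y₀ v₀

end FunctionRep

/-! ## Free order unit modules -/

/-- The ordered space `(A, C, u)` with multiplication `R`, identification `φ : M_A ≅ C(Y)` of its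
multiplicative domain, where `Y ⊆ ℝᵐ` is compact, and `M_A`-basis `e₀, …, eₙ`, is a free order unit
module of type `(n, m)` over `C(Y)`. -/
structure IsFreeOrderUnitModule {A : Type*} [AddCommGroup A] [Module ℝ A]
    {C : PointedCone ℝ A} {u : A} {X : Type*} [TopologicalSpace X]
    (R : FunctionRep C u X) {n m : ℕ} (Y : Compacts (Fin m → ℝ))
    (φ : R.multAlg ≃ₐ[ℝ] C(Y, ℝ)) (e : Module.Basis (Fin (n + 1)) R.multAlg A) : Prop where
  /-- the functions that represent `A` live on a compact Hausdorff space -/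
  compact : CompactSpace X
  t2 : T2Space X
  /-- `A` is an Archimedean order unit space -/
  aou : IsAOUSpace C u
  /-- `φ` is isometric for the norm that `M_A` inherits from `A` -/
  isometric : ∀ g : R.multAlg, ‖φ g‖ = orderUnitNorm C u (g • u)
  /-- `M_A` is finitely generated as a `C*`-algebra -/
  finitely_generated : ∃ S : Set R.multAlg, S.Finite ∧ ∀ (g : R.multAlg) (ε : ℝ), 0 < ε →
    ∃ h ∈ Algebra.adjoin ℝ S, orderUnitNorm C u ((g - h) • u) < ε
  /-- the unit of `C(Y)` acts as the identity -/
  one_act : ∀ a : A, φ.symm 1 • a = a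
  /-- the order unit is aligned with the basis -/
  unit_aligned : u = φ.symm 1 • e 0
  /-- each fiber has dimension `n + 1` -/
  fiber_dim : ∀ y : Y, Module.finrank ℝ (R.Fiber φ y) = n + 1
  /-- each fiber is an Archimedean order unit space, with order unit `[u]_y` -/
  fiber_aou : ∀ y : Y, IsAOUSpace (R.fiberCone φ y) (R.toFiber φ y u)
  /-- the order of `A` is determined fiberwise -/
  cone_iff : ∀ a : A, a ∈ C ↔ ∀ y : Y, R.toFiber φ y a ∈ R.fiberCone φ y
  /-- `y ↦ (A_y)⁺` is lower hemicontinuous -/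
  lhc : R.FiberLHC φ (fun y => {v | v ∈ R.fiberCone φ y})
  /-- `y ↦ (A_y)⁺` is upper hemicontinuous on bounded slices -/
  uhc : ∀ r : ℝ, 0 < r →
    R.FiberUHC φ (fun y => {v | v ∈ R.fiberCone φ y ∧ R.fiberNorm φ y v ≤ r})
  /-- the coefficient map `A → C(Y)ⁿ⁺¹` is a homeomorphism -/
  topological : ∀ (a : ℕ → A) (a₀ : A),
    Tendsto (fun k => orderUnitNorm C u (a k - a₀)) atTop (𝓝 0) ↔
      ∀ i, Tendsto (fun k => ‖φ (e.repr (a k) i) - φ (e.repr a₀ i)‖) atTop (𝓝 0)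

/-! ## Partially convex sets -/

/-- The slice `K_y = {x | (x, y) ∈ K}`. -/
def slice {n m : ℕ} (K : Set ((Fin n → ℝ) × (Fin m → ℝ))) (y : Fin m → ℝ) : Set (Fin n → ℝ) :=
  {x | (x, y) ∈ K}

/-- `K` is partially convex in `x`. -/
def IsPartiallyConvex {n m : ℕ} (K : Set ((Fin n → ℝ) × (Fin m → ℝ))) : Prop :=
  ∀ y ∈ Prod.snd '' K, Convex ℝ (slice K y)

/-- `K` is a regular partially convex set. -/
structure IsRegularPartiallyConvex {n m : ℕ} (K : Set ((Fin n → ℝ) × (Fin m → ℝ))) : Prop where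
  closed : IsClosed K
  convex : IsPartiallyConvex K
  interior_nonempty : ∀ y ∈ Prod.snd '' K, (interior (slice K y)).Nonempty
  lhc : LowerHemicontinuousOn (fun y => interior (slice K y)) (Prod.snd '' K)

/-- The projection `π_Y(K)`. -/
def projY {n m : ℕ} (K : Compacts ((Fin n → ℝ) × (Fin m → ℝ))) : Compacts (Fin m → ℝ) :=
  K.map Prod.snd continuous_snd

/-- The projection `π_Y` as a map `K → π_Y(K)`. -/
def toProjY {n m : ℕ} (K : Compacts ((Fin n → ℝ) × (Fin m → ℝ))) (z : K) : projY K :=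
  ⟨z.1.2, z.1, z.2, rfl⟩

/-- `Aff(S)`: the continuous affine functions on a (convex) set `S`. -/
def affFunctions {n : ℕ} (S : Set (Fin n → ℝ)) : Submodule ℝ C(S, ℝ) where
  carrier := {f | ∀ (p q r : S) (a b : ℝ), 0 ≤ a → 0 ≤ b → a + b = 1 →
    (r : Fin n → ℝ) = a • (p : Fin n → ℝ) + b • (q : Fin n → ℝ) → f r = a * f p + b * f q}
  zero_mem' := by intro p q r a b _ _ _ _; simp
  add_mem' := by
    intro f g hf hg p q r a b ha hb hab hr
    simp only [ContinuousMap.add_apply, hf p q r a b ha hb hab hr, hg p q r a b ha hb hab hr]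
    ring
  smul_mem' := by
    intro c f hf p q r a b ha hb hab hr
    simp only [ContinuousMap.smul_apply, smul_eq_mul, hf p q r a b ha hb hab hr]
    ring

/-- The restriction `f ↦ f(·, y)` of continuous functions on `K` to the slice `K_y`. -/
def restrictSlice {n m : ℕ} (K : Compacts ((Fin n → ℝ) × (Fin m → ℝ))) (y : Fin m → ℝ) :
    C(K, ℝ) →ₗ[ℝ] C(slice (K : Set ((Fin n → ℝ) × (Fin m → ℝ))) y, ℝ) where
  toFun f := f.comp ⟨fun x => ⟨((x : Fin n → ℝ), y), x.2⟩, by fun_prop⟩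
  map_add' _ _ := rfl
  map_smul' _ _ := rfl

/-- `C_aff(K)`: the continuous functions on `K` that are affine on every slice. -/
def caff {n m : ℕ} (K : Compacts ((Fin n → ℝ) × (Fin m → ℝ))) : Submodule ℝ C(K, ℝ) :=
  ⨅ y : projY K, (affFunctions (slice (K : Set ((Fin n → ℝ) × (Fin m → ℝ))) y)).comap
    (restrictSlice K y)

theorem mem_caff {n m : ℕ} {K : Compacts ((Fin n → ℝ) × (Fin m → ℝ))} {f : C(K, ℝ)} :
    f ∈ caff K ↔ ∀ y : projY K, restrictSlice K y f ∈ affFunctions (slice K y) := by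
  simp [caff, Submodule.mem_iInf]

/-- The pointwise positive cone of `C_aff(K)`. -/
def caffCone {n m : ℕ} (K : Compacts ((Fin n → ℝ) × (Fin m → ℝ))) : PointedCone ℝ (caff K) :=
  (PointedCone.positive ℝ C(K, ℝ)).comap (caff K).subtype

/-- The constant function `1` in `C_aff(K)`. -/
def caffOne {n m : ℕ} (K : Compacts ((Fin n → ℝ) × (Fin m → ℝ))) : caff K :=
  ⟨1, mem_caff.2 (by
    intro y p q r a b _ _ hab _
    simp [restrictSlice, hab])⟩

/-- The coordinate function `x_i` in `C_aff(K)`. -/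
def caffCoord {n m : ℕ} (K : Compacts ((Fin n → ℝ) × (Fin m → ℝ))) (i : Fin n) : caff K :=
  ⟨⟨fun z => z.1.1 i, by fun_prop⟩, mem_caff.2 (by
    intro y p q r a b _ _ _ hr
    simp [restrictSlice, hr])⟩

/-- The inclusion of `C_aff(K)` in `C(K)`. -/
def caffRep {n m : ℕ} (K : Compacts ((Fin n → ℝ) × (Fin m → ℝ))) :
    FunctionRep (caffCone K) (caffOne K) K where
  ι := (caff K).subtype
  injective := Subtype.val_injective
  map_unit := rfl
  mem_cone_iff _ := Iff.rfl

/-- The restriction `f ↦ f(·, y)` from `C_aff(K)` to `Aff(K_y)`. -/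
def caffRestrict {n m : ℕ} (K : Compacts ((Fin n → ℝ) × (Fin m → ℝ))) (y : projY K) :
    caff K →ₗ[ℝ] affFunctions (slice (K : Set ((Fin n → ℝ) × (Fin m → ℝ))) y) :=
  (restrictSlice K y).restrict (fun _ hf => mem_caff.1 hf y)

end

/-! Regularity enters through two geometric facts. First, near each `y₀` the slices contain a common
box (`exists_eventually_box_subset_slice`): the interior of `K_{y₀}` meets the `2ⁿ` open orthants
placed around a small box, lower hemicontinuity lets nearby slices meet them too, and by Hahn–Banach
a closed convex set meeting all of them contains the box. Second, the projection `K → Y` is open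
(`isOpenMap_toProjY`), because each slice lies in the closure of its interior.

The box controls coefficients. An affine function is determined by its values at the centre of the
box and at one shifted point per axis, and its coefficients are difference quotients of these
values. So the coefficients of `f ∈ C_aff(K)` are unique and continuous in `y` (`exists_coeff`),
which gives the basis. They are also bounded by a multiple of the supremum on the slice, uniformly
in `y` because `Y` is compact (`exists_coeff_bound`). This gives the homeomorphism with `C(Y)ⁿ⁺¹`
and the compactness behind upper hemicontinuity.

Openness controls multiplication and order. If `f` and `f²` are both affine on a slice, then `f` is
constant there, so multipliers descend to `Y`, continuously because an open surjection is a quotient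
map. A function that is nonnegative on one slice becomes nonnegative on `K` after adding the
slicewise maximum of its negative part, which is continuous in `y` and vanishes at the given slice.
Hence the quotient cone of a fiber is the pointwise cone (`toFiber_mem_fiberCone_iff`).

Finally `J_y` is the kernel of restriction to `K_y` (`fiberIdeal_eq_ker`): a function vanishing on
`K_y` has coefficients vanishing at `y`, and `|g a| ≤ ‖a‖ |g|` puts each term in the order ideal. -/

noncomputable section

/-! ## Affine functions on convex sets with nonempty interior -/

section Affine

variable {n : ℕ}

/-- The affine function `x ↦ c₀ + ∑ cᵢ xᵢ` on `ℝⁿ` with coefficients `c`. -/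
def affEval (c : Fin (n + 1) → ℝ) (x : Fin n → ℝ) : ℝ :=
  c 0 + ∑ i, c i.succ * x i

theorem affEval_add (c d : Fin (n + 1) → ℝ) (x : Fin n → ℝ) :
    affEval (c + d) x = affEval c x + affEval d x := by
  simp only [affEval, Pi.add_apply, add_mul, Finset.sum_add_distrib]
  ring

theorem affEval_smul (a : ℝ) (c : Fin (n + 1) → ℝ) (x : Fin n → ℝ) :
    affEval (a • c) x = a * affEval c x := by
  simp only [affEval, Pi.smul_apply, smul_eq_mul, mul_add, Finset.mul_sum, mul_assoc]

theorem affEval_convex_comb (c : Fin (n + 1) → ℝ) (x y : Fin n → ℝ) {a b : ℝ} (hab : a + b = 1) :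
    affEval c (a • x + b • y) = a * affEval c x + b * affEval c y := by
  have h : c 0 = a * c 0 + b * c 0 := by rw [← add_mul, hab, one_mul]
  have h2 : ∑ i, c i.succ * (a • x + b • y) i
      = a * ∑ i, c i.succ * x i + b * ∑ i, c i.succ * y i := by
    rw [Finset.mul_sum, Finset.mul_sum, ← Finset.sum_add_distrib]
    refine Finset.sum_congr rfl fun i _ => ?_
    simp only [Pi.add_apply, Pi.smul_apply, smul_eq_mul]
    ring
  simp only [affEval, h2]
  linarith

theorem abs_affEval_le (c : Fin (n + 1) → ℝ) (x : Fin n → ℝ) :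
    |affEval c x| ≤ (∑ i, |c i|) * (1 + ‖x‖) := by
  have h : |∑ i, c i.succ * x i| ≤ (∑ i : Fin n, |c i.succ|) * ‖x‖ := by
    rw [Finset.sum_mul]
    refine (Finset.abs_sum_le_sum_abs _ _).trans (Finset.sum_le_sum fun i _ => ?_)
    rw [abs_mul]
    exact mul_le_mul_of_nonneg_left (norm_le_pi_norm x i) (abs_nonneg _)
  have h0 : 0 ≤ ∑ i : Fin n, |c i.succ| := Finset.sum_nonneg fun i _ => abs_nonneg _
  rw [Fin.sum_univ_succ]
  refine (abs_add_le _ _).trans ?_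
  nlinarith [mul_nonneg (abs_nonneg (c 0)) (norm_nonneg x)]

theorem affEval_add_single (c : Fin (n + 1) → ℝ) (p : Fin n → ℝ) (i : Fin n) (r : ℝ) :
    affEval c (p + Pi.single i r) = affEval c p + c i.succ * r := by
  simp only [affEval, Pi.add_apply, mul_add, Finset.sum_add_distrib]
  rw [Finset.sum_eq_single_of_mem (f := fun j => c j.succ * (Pi.single i r : Fin n → ℝ) j) i
    (Finset.mem_univ i)]
  · simp only [Pi.single_eq_same]
    ring
  · intro j _ hj
    simp [Pi.single_eq_of_ne hj]

/-- The box with centre `p` and half side length `r`. -/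
def box (p : Fin n → ℝ) (r : ℝ) : Set (Fin n → ℝ) := {x | ∀ i, |x i - p i| ≤ r}

theorem self_mem_box (p : Fin n → ℝ) {r : ℝ} (hr : 0 ≤ r) : p ∈ box p r := fun i => by simpa

theorem add_single_mem_box (p : Fin n → ℝ) (i : Fin n) {r s : ℝ} (hs : |s| ≤ r) :
    p + Pi.single i s ∈ box p r := by
  intro j
  rcases eq_or_ne j i with rfl | hj
  · simpa using hs
  · simpa [Pi.single_eq_of_ne hj] using (abs_nonneg s).trans hs

/-- A closed convex set that meets each of the `2ⁿ` orthants around `box p r` contains this box. -/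
theorem box_subset_of_orthants {S : Set (Fin n → ℝ)} (hS : Convex ℝ S) (hc : IsClosed S)
    {p : Fin n → ℝ} {r : ℝ}
    (h : ∀ σ : Fin n → Bool, ∃ x ∈ S, ∀ i, r ≤ (bif σ i then 1 else -1) * (x i - p i)) :
    box p r ⊆ S := by
  intro q hq
  by_contra hqS
  obtain ⟨f, u, hfq, hfS⟩ := geometric_hahn_banach_point_closed hS hc hqS
  -- The orthant is chosen so that each coordinate step from `q` to `x` does not increase `f`; this
  -- contradicts `f q < u < f x`.
  obtain ⟨x, hxS, hx⟩ := h fun i => decide (f (Pi.single i 1) ≤ 0)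
  have hle : f (x - q) ≤ 0 := by
    rw [← LinearMap.sum_single_apply (fun _ : Fin n => ℝ) (x - q), map_sum]
    refine Finset.sum_nonpos fun i _ => ?_
    have e : (Pi.single i ((x - q) i) : Fin n → ℝ)
        = (x i - q i) • (Pi.single i (1 : ℝ) : Fin n → ℝ) := by
      simp [← Pi.single_smul]
    rw [e, map_smul, smul_eq_mul]
    have h1 := hx i
    have h2 := abs_le.1 (hq i)
    by_cases hf : f (Pi.single i 1) ≤ 0
    · simp only [hf, decide_true, cond_true, one_mul] at h1
      exact mul_nonpos_of_nonneg_of_nonpos (by linarith) hf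
    · simp only [hf, decide_false, cond_false] at h1
      exact mul_nonpos_of_nonpos_of_nonneg (by linarith) (not_le.1 hf).le
  rw [map_sub] at hle
  linarith [hfS x hxS]

/-- An affine function on a convex set that vanishes at the vertices of a small simplex is zero. -/
theorem affine_eq_zero_of_box {S : Set (Fin n → ℝ)} (hS : Convex ℝ S) {g : (Fin n → ℝ) → ℝ}
    (hg : ∀ x ∈ S, ∀ y ∈ S, ∀ a b : ℝ, 0 ≤ a → 0 ≤ b → a + b = 1 →
      g (a • x + b • y) = a * g x + b * g y)
    {p : Fin n → ℝ} {r : ℝ} (hr : 0 < r) (hb : box p r ⊆ S) (hp : g p = 0)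
    (hi : ∀ i, g (p + Pi.single i r) = 0) : ∀ x ∈ S, g x = 0 := by
  intro x hx
  have hpS : p ∈ S := hb (self_mem_box p hr.le)
  -- The averaging below divides by `n`.
  rcases Nat.eq_zero_or_pos n with rfl | hn
  · rwa [Subsingleton.elim x p]
  have hline : ∀ i s, |s| ≤ r → g (p + Pi.single i s) = 0 := by
    intro i s hs
    have hrS := hb (add_single_mem_box p i (abs_of_pos hr).le)
    have hsS := hb (add_single_mem_box p i hs)
    rcases le_or_gt 0 s with h0 | h0
    · have h1 : s ≤ r := (le_abs_self s).trans hs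
      have := hg p hpS _ hrS (1 - s / r) (s / r) (sub_nonneg.2 ((div_le_one hr).2 h1))
        (by positivity) (by ring)
      rw [hp, hi i, mul_zero, mul_zero, add_zero] at this
      rw [← this]
      congr 1
      ext j
      rcases eq_or_ne j i with rfl | hj
      · simp
        field_simp
        ring
      · simp [Pi.single_eq_of_ne hj]
        ring
    -- For `s < 0` it is `p` that lies between the other two points, with positive weight on the
    -- unknown value.
    · have hrs : 0 < r - s := by linarith
      have := hg _ hsS _ hrS (r / (r - s)) (-s / (r - s)) (by positivity)
        (div_nonneg (by linarith) hrs.le) (by field_simp; ring)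
      have e : (r / (r - s)) • (p + Pi.single i s) + (-s / (r - s)) • (p + Pi.single i r) = p := by
        ext j
        rcases eq_or_ne j i with rfl | hj
        · simp
          field_simp
          ring
        · simp [Pi.single_eq_of_ne hj]
          field_simp
          ring
      rw [e, hp, hi i, mul_zero, add_zero] at this
      exact (mul_eq_zero.1 this.symm).resolve_left (div_pos hr hrs).ne'
  have hn' : (0 : ℝ) < n := by exact_mod_cast hn
  -- The scale `t` shrinks `x` towards `p` until `(1 - t) p + t x` is the average of `n` points on
  -- the axes through `p`, all inside the box, where `g` vanishes. Being both convex and concave,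
  -- `g` vanishes at the average, hence at `x`.
  set D : ℝ := n * ‖x - p‖ with hD
  have hD0 : 0 ≤ D := by positivity
  set t : ℝ := r / (r + D) with ht
  have ht0 : 0 < t := by positivity
  have ht1 : t ≤ 1 := (div_le_one (by positivity)).2 (by linarith)
  have htD : t * D ≤ r := by
    rw [ht, div_mul_eq_mul_div, div_le_iff₀ (by positivity)]
    nlinarith
  have hsmall : ∀ i, |n * (t * (x i - p i))| ≤ r := by
    intro i
    have h1 : |x i - p i| ≤ ‖x - p‖ := norm_le_pi_norm (x - p) i
    rw [abs_mul, abs_mul, abs_of_pos ht0, abs_of_pos hn']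
    refine le_trans ?_ htD
    rw [hD]
    calc (n : ℝ) * (t * |x i - p i|) = t * (n * |x i - p i|) := by ring
      _ ≤ t * (n * ‖x - p‖) := by gcongr
  have hconv : ConvexOn ℝ S g := ⟨hS, fun x hx y hy a b ha hb hab => (hg x hx y hy a b ha hb hab).le⟩
  have hconc : ConcaveOn ℝ S g :=
    ⟨hS, fun x hx y hy a b ha hb hab => (hg x hx y hy a b ha hb hab).ge⟩
  have hw : ∑ _i : Fin n, (1 / n : ℝ) = 1 := by
    simp
    field_simp
  have hmem : ∀ i ∈ (Finset.univ : Finset (Fin n)),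
      p + Pi.single i (n * (t * (x i - p i))) ∈ S :=
    fun i _ => hb (add_single_mem_box p i (hsmall i))
  have h0 : ∑ i : Fin n, (1 / n : ℝ) • g (p + Pi.single i (n * (t * (x i - p i)))) = 0 :=
    Finset.sum_eq_zero fun i _ => by rw [hline i _ (hsmall i), smul_zero]
  have hle := hconv.map_sum_le (t := Finset.univ) (fun _ _ => by positivity) hw hmem
  have hge := hconc.le_map_sum (t := Finset.univ) (fun _ _ => by positivity) hw hmem
  have e : ∑ i : Fin n, (1 / n : ℝ) • (p + Pi.single i (n * (t * (x i - p i))))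
      = (1 - t) • p + t • x := by
    ext j
    simp only [Finset.sum_apply, Pi.smul_apply, Pi.add_apply, smul_eq_mul, mul_add,
      Finset.sum_add_distrib, ← Finset.sum_mul, hw, one_mul]
    rw [Finset.sum_eq_single_of_mem j (Finset.mem_univ j)]
    · simp only [Pi.single_eq_same]
      field_simp
      ring
    · intro i _ hij
      simp [Pi.single_eq_of_ne hij.symm]
  rw [h0] at hle hge
  have hzero := le_antisymm hle hge
  rw [e, hg p hpS x hx _ _ (by linarith) ht0.le (by ring), hp, mul_zero, zero_add] at hzero
  exact (mul_eq_zero.1 hzero).resolve_left ht0.ne'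

/-- Difference quotients along the edges of the box give the slopes, the value at `p` the constant
term; the difference from `f` vanishes at the vertices of a simplex in the box. -/
theorem exists_affEval_of_mem_affFunctions {S : Set (Fin n → ℝ)} (hS : Convex ℝ S) {p : Fin n → ℝ}
    {r : ℝ} (hr : 0 < r) (hb : box p r ⊆ S) {f : C(S, ℝ)} (hf : f ∈ affFunctions S) :
    ∃ c : Fin (n + 1) → ℝ, ∀ x : S, f x = affEval c x := by
  classical
  set F : (Fin n → ℝ) → ℝ := fun x => if h : x ∈ S then f ⟨x, h⟩ else 0 with hF
  have hFS : ∀ x (h : x ∈ S), F x = f ⟨x, h⟩ := fun x h => by simp [hF, h]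
  set d : Fin n → ℝ := fun i => (F (p + Pi.single i r) - F p) / r with hd
  set c : Fin (n + 1) → ℝ := Fin.cons (F p - ∑ i, d i * p i) d with hc
  have hcp : affEval c p = F p := by simp [affEval, hc]
  refine ⟨c, fun x => ?_⟩
  have := affine_eq_zero_of_box hS (g := fun x => F x - affEval c x) (fun x hx y hy a b ha hb hab => by
    have hxy : a • x + b • y ∈ S := hS hx hy ha hb hab
    simp only [affEval_convex_comb c x y hab, hFS _ hx, hFS _ hy, hFS _ hxy,
      hf ⟨x, hx⟩ ⟨y, hy⟩ ⟨_, hxy⟩ a b ha hb hab rfl]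
    ring) hr hb (by simp [hcp]) (fun i => by
      rw [affEval_add_single, hcp]
      simp only [hc, Fin.cons_succ, hd]
      field_simp
      ring) x x.2
  rw [← sub_eq_zero, ← this, hFS x x.2]

/-- The coefficients of an affine function are bounded by its supremum over a box. -/
theorem abs_coeff_le_of_box {c : Fin (n + 1) → ℝ} {p : Fin n → ℝ} {r B : ℝ} (hr : 0 < r)
    (h : ∀ x ∈ box p r, |affEval c x| ≤ B) (i : Fin (n + 1)) :
    |c i| ≤ (1 + 2 / r + (∑ j, 2 / r * |p j|)) * B := by
  have hp := h p (self_mem_box p hr.le)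
  have hB : 0 ≤ B := (abs_nonneg _).trans hp
  -- A slope is a difference of two values of size at most `B`, divided by `r`; the constant term is
  -- the value at `p` minus the slopes times the coordinates of `p`.
  have hsucc : ∀ j : Fin n, |c j.succ| ≤ 2 / r * B := by
    intro j
    have h1 := h _ (add_single_mem_box p j (abs_of_pos hr).le)
    rw [affEval_add_single] at h1
    have h2 : |c j.succ * r| ≤ 2 * B := by
      rw [abs_le] at *
      constructor <;> linarith
    rw [abs_mul, abs_of_pos hr] at h2
    rw [div_mul_eq_mul_div, le_div_iff₀ hr]
    exact h2
  have hs0 : 0 ≤ ∑ j, 2 / r * |p j| := Finset.sum_nonneg fun j _ => by positivity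
  have hr2 : 0 ≤ 2 / r := by positivity
  refine Fin.cases ?_ (fun j => ?_) i
  · have h1 : |∑ j, c j.succ * p j| ≤ (∑ j, 2 / r * |p j|) * B := by
      rw [Finset.sum_mul]
      refine (Finset.abs_sum_le_sum_abs _ _).trans (Finset.sum_le_sum fun j _ => ?_)
      rw [abs_mul]
      calc |c j.succ| * |p j| ≤ 2 / r * B * |p j| :=
            mul_le_mul_of_nonneg_right (hsucc j) (abs_nonneg _)
        _ = _ := by ring
    have h2 : c 0 = affEval c p - ∑ j, c j.succ * p j := by simp [affEval]
    have h3 : |c 0| ≤ |affEval c p| + |∑ j, c j.succ * p j| := by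
      rw [h2]
      exact abs_sub _ _
    nlinarith [mul_nonneg hr2 hB]
  · refine (hsucc j).trans (mul_le_mul_of_nonneg_right ?_ hB)
    linarith

theorem eq_zero_of_affEval_eq_zero_of_box {c : Fin (n + 1) → ℝ} {p : Fin n → ℝ} {r : ℝ}
    (hr : 0 < r) (h : ∀ x ∈ box p r, affEval c x = 0) : c = 0 := by
  ext i
  have := abs_coeff_le_of_box (B := 0) hr (fun x hx => (abs_nonpos_iff.2 (h x hx))) i
  rw [mul_zero] at this
  exact abs_nonpos_iff.1 this

end Affine

/-! ## Maxima over the fibres of an open map -/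

/-- The maxima of a continuous function over the fibres of a continuous open surjection from a
compact space form a continuous function. -/
theorem exists_continuousMap_isGreatest_fiber {X Y : Type*} [TopologicalSpace X] [CompactSpace X]
    [TopologicalSpace Y] [T2Space Y] {π : X → Y} (hc : Continuous π) (ho : IsOpenMap π)
    (hs : Function.Surjective π) (h : C(X, ℝ)) :
    ∃ g : C(Y, ℝ), ∀ y, IsGreatest (h '' (π ⁻¹' {y})) (g y) := by
  have hex : ∀ y, ∃ a, IsGreatest (h '' (π ⁻¹' {y})) a := fun y =>
    (((isClosed_singleton.preimage hc).isCompact.image h.continuous).exists_isGreatest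
      (((singleton_nonempty y).preimage hs).image h))
  choose g hg using hex
  -- Openness of `π` makes the maximum lower semicontinuous; compactness of `X` makes it upper
  -- semicontinuous.
  refine ⟨⟨g, OrderTopology.continuous_iff.2 fun a => ⟨?_, ?_⟩⟩, hg⟩
  · have e : g ⁻¹' Ioi a = π '' (h ⁻¹' Ioi a) := by
      ext y
      constructor
      · intro hy
        obtain ⟨x, hx, hxy⟩ := (hg y).1
        exact ⟨x, by rw [mem_preimage, hxy]; exact hy, hx⟩
      · rintro ⟨x, hx, rfl⟩
        exact lt_of_lt_of_le (mem_Ioi.1 hx) ((hg (π x)).2 ⟨x, rfl, rfl⟩)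
    rw [e]
    exact ho _ (isOpen_Ioi.preimage h.continuous)
  · have e : g ⁻¹' Iio a = (π '' (h ⁻¹' Ici a))ᶜ := by
      ext y
      constructor
      · rintro hy ⟨x, hx, rfl⟩
        exact absurd ((hg (π x)).2 ⟨x, rfl, rfl⟩) (not_le.2 (lt_of_lt_of_le hy hx))
      · intro hy
        by_contra hy'
        rw [mem_preimage, mem_Iio, not_lt] at hy'
        obtain ⟨x, hx, hxy⟩ := (hg y).1
        exact hy ⟨x, by rw [mem_preimage, hxy]; exact hy', hx⟩
    rw [e]
    exact (((isClosed_Ici.preimage h.continuous).isCompact.image hc).isClosed).isOpen_compl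

/-! ## The projection of a regular partially convex set -/

section Regular

variable {n m : ℕ} {K : Compacts ((Fin n → ℝ) × (Fin m → ℝ))}

theorem continuous_toProjY (K : Compacts ((Fin n → ℝ) × (Fin m → ℝ))) : Continuous (toProjY K) :=
  Continuous.subtype_mk (by fun_prop) _

theorem toProjY_surjective (K : Compacts ((Fin n → ℝ) × (Fin m → ℝ))) :
    Function.Surjective (toProjY K) := by
  rintro ⟨_, z, hz, rfl⟩
  exact ⟨⟨z, hz⟩, rfl⟩

theorem projY_mem_image (y : projY K) :
    (y : Fin m → ℝ) ∈ Prod.snd '' (K : Set ((Fin n → ℝ) × (Fin m → ℝ))) := y.2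

theorem isClosed_slice (K : Compacts ((Fin n → ℝ) × (Fin m → ℝ))) (y : Fin m → ℝ) :
    IsClosed (slice (K : Set ((Fin n → ℝ) × (Fin m → ℝ))) y) :=
  K.isCompact.isClosed.preimage (by fun_prop : Continuous fun x : Fin n → ℝ => (x, y))

instance (y : Fin m → ℝ) : CompactSpace (slice (K : Set ((Fin n → ℝ) × (Fin m → ℝ))) y) := by
  refine isCompact_iff_compactSpace.1 ((K.isCompact.image continuous_fst).of_isClosed_subset
    (isClosed_slice K y) ?_)
  intro x hx
  exact ⟨(x, y), hx, rfl⟩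

variable (hK : IsRegularPartiallyConvex (K : Set ((Fin n → ℝ) × (Fin m → ℝ))))

include hK

theorem convex_slice (y : projY K) :
    Convex ℝ (slice (K : Set ((Fin n → ℝ) × (Fin m → ℝ))) y) :=
  hK.convex y (projY_mem_image y)

theorem eventually_inter_interior_slice (y₀ : projY K) {U : Set (Fin n → ℝ)} (hU : IsOpen U)
    (h : (interior (slice (K : Set ((Fin n → ℝ) × (Fin m → ℝ))) y₀) ∩ U).Nonempty) :
    ∀ᶠ y : projY K in 𝓝 y₀,
      (interior (slice (K : Set ((Fin n → ℝ) × (Fin m → ℝ))) y) ∩ U).Nonempty := by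
  have h1 := hK.lhc y₀ (projY_mem_image y₀) U ⟨hU, h⟩
  have h2 : Tendsto (Subtype.val : projY K → (Fin m → ℝ)) (𝓝 y₀)
      (𝓝[Prod.snd '' (K : Set ((Fin n → ℝ) × (Fin m → ℝ)))] (y₀ : Fin m → ℝ)) :=
    tendsto_nhdsWithin_iff.2 ⟨continuous_subtype_val.continuousAt,
      Eventually.of_forall fun y => projY_mem_image y⟩
  exact (h2.eventually h1).mono fun y hy => hy.2

/-- A neighbourhood of a point of a slice already meets the interior of that slice, and lower
hemicontinuity carries the intersection to nearby slices. -/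
theorem isOpenMap_toProjY : IsOpenMap (toProjY K) := by
  rw [IsOpenMap.eq_1]
  intro V hV
  rw [isOpen_iff_mem_nhds]
  rintro _ ⟨⟨⟨x₀, y₀⟩, hz⟩, hzV, rfl⟩
  obtain ⟨W, hW, rfl⟩ := isOpen_induced_iff.1 hV
  obtain ⟨U, T, hU, hT, hxU, hyT, hUT⟩ := isOpen_prod_iff.1 hW x₀ y₀ hzV
  have hx : x₀ ∈ closure (interior (slice (K : Set ((Fin n → ℝ) × (Fin m → ℝ))) y₀)) := by
    rw [(hK.convex y₀ ⟨_, hz, rfl⟩).closure_interior_eq_closure_of_nonempty_interior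
      (hK.interior_nonempty y₀ ⟨_, hz, rfl⟩)]
    exact subset_closure hz
  have hne := mem_closure_iff.1 hx U hU hxU
  have h1 := eventually_inter_interior_slice hK (toProjY K ⟨(x₀, y₀), hz⟩) hU
    (by rwa [inter_comm] at hne)
  have h2 : ∀ᶠ y : projY K in 𝓝 (toProjY K ⟨(x₀, y₀), hz⟩), (y : Fin m → ℝ) ∈ T :=
    continuous_subtype_val.continuousAt.eventually (hT.mem_nhds hyT)
  filter_upwards [h1, h2] with y ⟨x, hxK, hxU'⟩ hyT'
  exact ⟨⟨(x, y), (interior_subset hxK : x ∈ slice _ _)⟩, hUT ⟨hxU', hyT'⟩, rfl⟩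

/-- Nearby slices contain a common box. -/
theorem exists_eventually_box_subset_slice (y₀ : projY K) :
    ∃ (p : Fin n → ℝ) (r : ℝ), 0 < r ∧ ∀ᶠ y : projY K in 𝓝 y₀,
      box p r ⊆ slice (K : Set ((Fin n → ℝ) × (Fin m → ℝ))) y := by
  obtain ⟨p, hp⟩ := hK.interior_nonempty y₀ (projY_mem_image y₀)
  obtain ⟨δ, hδ, hball⟩ := Metric.isOpen_iff.1 isOpen_interior p hp
  -- The test points `p ± 2r` lie strictly beyond distance `r` in every coordinate, yet inside the
  -- sup-norm ball of radius `δ`.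
  set r := δ / 3 with hr
  have hr0 : 0 < r := by positivity
  set U : (Fin n → Bool) → Set (Fin n → ℝ) :=
    fun σ => {x | ∀ i, r < (bif σ i then 1 else -1) * (x i - p i)} with hU
  refine ⟨p, r, hr0, ?_⟩
  have hev : ∀ᶠ y : projY K in 𝓝 y₀, ∀ σ,
      (interior (slice (K : Set ((Fin n → ℝ) × (Fin m → ℝ))) y) ∩ U σ).Nonempty := by
    refine eventually_all.2 fun σ => eventually_inter_interior_slice hK y₀ ?_ ?_
    · simp only [hU, ofPred_forall]
      exact isOpen_iInter_of_finite fun i => isOpen_lt (by fun_prop) (by fun_prop)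
    · refine ⟨fun i => p i + (bif σ i then 1 else -1) * (2 * r), hball ?_, fun i => ?_⟩
      · rw [Metric.mem_ball, dist_pi_lt_iff hδ]
        intro i
        rw [Real.dist_eq]
        cases σ i <;> simp [abs_of_pos hr0] <;> linarith
      · rw [add_sub_cancel_left]
        cases σ i <;> simp <;> linarith
  filter_upwards [hev] with y hy
  refine box_subset_of_orthants (convex_slice hK y) (isClosed_slice K y) fun σ => ?_
  obtain ⟨x, hx, hxU⟩ := hy σ
  exact ⟨x, interior_subset hx, fun i => (hxU i).le⟩

theorem exists_box_subset_slice (y : projY K) :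
    ∃ (p : Fin n → ℝ) (r : ℝ), 0 < r ∧
      box p r ⊆ slice (K : Set ((Fin n → ℝ) × (Fin m → ℝ))) y := by
  obtain ⟨p, r, hr, h⟩ := exists_eventually_box_subset_slice hK y
  exact ⟨p, r, hr, h.self_of_nhds⟩

theorem eq_zero_of_affEval_eq_zero_of_slice (y : projY K) {c : Fin (n + 1) → ℝ}
    (h : ∀ x ∈ slice (K : Set ((Fin n → ℝ) × (Fin m → ℝ))) y, affEval c x = 0) : c = 0 := by
  obtain ⟨p, r, hr, hb⟩ := exists_box_subset_slice hK y
  exact eq_zero_of_affEval_eq_zero_of_box hr fun x hx => h x (hb hx)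

/-- The coefficients of affine functions on the slices are uniformly bounded by the suprema. -/
theorem exists_coeff_bound : ∃ M : ℝ, ∀ (y : projY K) (c : Fin (n + 1) → ℝ) (B : ℝ),
    (∀ x ∈ slice (K : Set ((Fin n → ℝ) × (Fin m → ℝ))) y, |affEval c x| ≤ B) →
      ∀ i, |c i| ≤ M * B := by
  have key := isCompact_univ (X := projY K) |>.induction_on
    (p := fun S => ∃ M : ℝ, ∀ y ∈ S, ∀ (c : Fin (n + 1) → ℝ) (B : ℝ),
      (∀ x ∈ slice (K : Set ((Fin n → ℝ) × (Fin m → ℝ))) y, |affEval c x| ≤ B) →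
        ∀ i, |c i| ≤ M * B) ⟨0, by simp⟩
    (fun S T hST ⟨M, hM⟩ => ⟨M, fun y hy => hM y (hST hy)⟩) ?_ ?_
  · obtain ⟨M, hM⟩ := key
    exact ⟨M, fun y => hM y (mem_univ y)⟩
  · rintro S T ⟨M, hM⟩ ⟨N, hN⟩
    refine ⟨max M N, fun y hy c B hB i => ?_⟩
    -- A slice is nonempty, so `B` is nonnegative and the constant may be enlarged.
    have hB0 : 0 ≤ B := by
      obtain ⟨x, hx⟩ := hK.interior_nonempty y (projY_mem_image y)
      exact (abs_nonneg _).trans (hB x (interior_subset hx))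
    rcases hy with hy | hy
    · exact (hM y hy c B hB i).trans (mul_le_mul_of_nonneg_right (le_max_left _ _) hB0)
    · exact (hN y hy c B hB i).trans (mul_le_mul_of_nonneg_right (le_max_right _ _) hB0)
  · intro y _
    obtain ⟨p, r, hr, h⟩ := exists_eventually_box_subset_slice hK y
    exact ⟨_, mem_nhdsWithin_of_mem_nhds h, _, fun y' hy' c B hB i =>
      abs_coeff_le_of_box hr (fun x hx => hB x (hy' hx)) i⟩

/-! ## Coefficients of the functions in `C_aff(K)` -/

/-- Near `y₀` one box serves all slices, so the coefficients are difference quotients at points `p`,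
`p + r eᵢ` that do not move with `y`. -/
theorem exists_coeff (f : caff K) : ∃ c : C(projY K, Fin (n + 1) → ℝ),
    ∀ z : K, (f : C(K, ℝ)) z = affEval (c (toProjY K z)) z.1.1 := by
  -- By Tietze, `y ↦ F (p, y)` is continuous on all of `Y`, also where `(p, y)` leaves `K`.
  obtain ⟨F, hF⟩ := ContinuousMap.exists_restrict_eq K.isCompact.isClosed (f : C(K, ℝ))
  have hFf : ∀ z : K, (f : C(K, ℝ)) z = F z := fun z => by rw [← hF]; rfl
  have hex : ∀ y : projY K, ∃ c : Fin (n + 1) → ℝ,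
      ∀ x ∈ slice (K : Set ((Fin n → ℝ) × (Fin m → ℝ))) y, F (x, y) = affEval c x := by
    intro y
    obtain ⟨p, r, hr, hb⟩ := exists_box_subset_slice hK y
    obtain ⟨c, hc⟩ := exists_affEval_of_mem_affFunctions (convex_slice hK y) hr hb
      (mem_caff.1 f.2 y)
    exact ⟨c, fun x hx => by rw [← hc ⟨x, hx⟩]; exact (hFf ⟨(x, y), hx⟩).symm⟩
  choose c hc using hex
  have hcont : Continuous c := by
    rw [continuous_iff_continuousAt]
    intro y₀
    obtain ⟨p, r, hr, hb⟩ := exists_eventually_box_subset_slice hK y₀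
    have hs : ∀ i : Fin n, (fun y : projY K => (F (p + Pi.single i r, y) - F (p, y)) / r)
        =ᶠ[𝓝 y₀] fun y => c y i.succ := by
      intro i
      filter_upwards [hb] with y hy
      rw [hc y _ (hy (add_single_mem_box p i (abs_of_pos hr).le)),
        hc y _ (hy (self_mem_box p hr.le)), affEval_add_single]
      field_simp
      ring
    have hsc : ∀ i : Fin n, ContinuousAt (fun y => c y i.succ) y₀ := fun i =>
      ContinuousAt.congr (by fun_prop) (hs i)
    refine continuousAt_pi.2 fun i => Fin.cases ?_ hsc i
    have h0 : (fun y : projY K => F (p, y) - ∑ i, c y i.succ * p i) =ᶠ[𝓝 y₀] fun y => c y 0 := by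
      filter_upwards [hb] with y hy
      rw [hc y _ (hy (self_mem_box p hr.le))]
      simp [affEval]
    refine ContinuousAt.congr (ContinuousAt.sub (by fun_prop) ?_) h0
    exact tendsto_finsetSum _ fun i _ => (hsc i).mul continuousAt_const
  exact ⟨⟨c, hcont⟩, fun z => by rw [hFf]; exact hc (toProjY K z) z.1.1 z.2⟩

end Regular

/-! ## The multiplicative domain of `C_aff(K)` -/

section MultiplicativeDomain

variable {n m : ℕ} {K : Compacts ((Fin n → ℝ) × (Fin m → ℝ))}

/-- The element `∑ cᵢ eᵢ` of `C_aff(K)`. -/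
def caffOfCoeff (c : C(projY K, Fin (n + 1) → ℝ)) : caff K :=
  ⟨⟨fun z => affEval (c (toProjY K z)) z.1.1, by
    have := continuous_toProjY K
    unfold affEval
    fun_prop⟩, mem_caff.2 (by
    intro y p q r a b _ _ hab hr
    have h : ∀ x : slice (K : Set ((Fin n → ℝ) × (Fin m → ℝ))) y,
        toProjY K ⟨((x : Fin n → ℝ), y), x.2⟩ = y := fun _ => rfl
    simp only [restrictSlice, LinearMap.coe_mk, AddHom.coe_mk, ContinuousMap.comp_apply,
      ContinuousMap.coe_mk, h]
    rw [hr, affEval_convex_comb _ _ _ hab])⟩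

/-- The element `g ∘ π_Y` of `C_aff(K)`. -/
def pullback (g : C(projY K, ℝ)) : caff K :=
  ⟨g.comp ⟨toProjY K, continuous_toProjY K⟩, mem_caff.2 (by
    intro y p q r a b _ _ hab _
    have h : ∀ x : slice (K : Set ((Fin n → ℝ) × (Fin m → ℝ))) y,
        toProjY K ⟨((x : Fin n → ℝ), y), x.2⟩ = y := fun _ => rfl
    simp only [restrictSlice, LinearMap.coe_mk, AddHom.coe_mk, ContinuousMap.comp_apply,
      ContinuousMap.coe_mk, h, ← add_mul, hab, one_mul])⟩

theorem pullback_mul_mem (g : C(projY K, ℝ)) (f : caff K) :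
    (pullback g : C(K, ℝ)) * f ∈ caff K := by
  refine mem_caff.2 ?_
  intro y p q r a b ha hb hab hr
  have h : ∀ x : slice (K : Set ((Fin n → ℝ) × (Fin m → ℝ))) y,
      restrictSlice K y ((pullback g : C(K, ℝ)) * f) x = g y * restrictSlice K y f x :=
    fun _ => rfl
  rw [h, h, h, mem_caff.1 f.2 y p q r a b ha hb hab hr]
  ring

theorem pullback_mem_multAlg (g : C(projY K, ℝ)) :
    (pullback g : C(K, ℝ)) ∈ (caffRep K).multAlg :=
  ⟨pullback g, fun a => ⟨⟨_, pullback_mul_mem g a⟩, rfl⟩, rfl⟩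

/-- An element of the multiplicative domain is constant on the slices: both it and its square are
affine there. -/
theorem multAlg_apply_eq (hK : IsRegularPartiallyConvex (K : Set ((Fin n → ℝ) × (Fin m → ℝ))))
    (g : (caffRep K).multAlg) {z w : K} (h : toProjY K z = toProjY K w) :
    (g : C(K, ℝ)) z = (g : C(K, ℝ)) w := by
  obtain ⟨_, f, hf, rfl⟩ := g
  obtain ⟨b, hb⟩ := hf f
  have hb' : (b : C(K, ℝ)) = (f : C(K, ℝ)) * f := hb
  change (f : C(K, ℝ)) z = (f : C(K, ℝ)) w
  obtain ⟨⟨x₁, y⟩, h₁⟩ := z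
  obtain ⟨⟨x₂, y₂⟩, h₂⟩ := w
  obtain rfl : y = y₂ := congrArg Subtype.val h
  set y' : projY K := toProjY K ⟨(x₁, y), h₁⟩ with hy'
  have hm : (1 / 2 : ℝ) • x₁ + (1 / 2 : ℝ) • x₂ ∈
      slice (K : Set ((Fin n → ℝ) × (Fin m → ℝ))) y :=
    convex_slice hK y' h₁ h₂ (by norm_num) (by norm_num) (by norm_num)
  have e1 : (f : C(K, ℝ)) ⟨(_, y), hm⟩ = 1 / 2 * (f : C(K, ℝ)) ⟨(x₁, y), h₁⟩
      + 1 / 2 * (f : C(K, ℝ)) ⟨(x₂, y), h₂⟩ :=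
    mem_caff.1 f.2 y' ⟨x₁, h₁⟩ ⟨x₂, h₂⟩ ⟨_, hm⟩ (1 / 2) (1 / 2) (by norm_num) (by norm_num)
      (by norm_num) rfl
  have e2 : (b : C(K, ℝ)) ⟨(_, y), hm⟩ = 1 / 2 * (b : C(K, ℝ)) ⟨(x₁, y), h₁⟩
      + 1 / 2 * (b : C(K, ℝ)) ⟨(x₂, y), h₂⟩ :=
    mem_caff.1 b.2 y' ⟨x₁, h₁⟩ ⟨x₂, h₂⟩ ⟨_, hm⟩ (1 / 2) (1 / 2) (by norm_num) (by norm_num)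
      (by norm_num) rfl
  rw [hb'] at e2
  simp only [ContinuousMap.mul_apply, e1] at e2
  -- With values `a`, `b` at the endpoints, the midpoint gives `((a + b) / 2)² = (a² + b²) / 2`.
  have : ((f : C(K, ℝ)) ⟨(x₁, y), h₁⟩ - (f : C(K, ℝ)) ⟨(x₂, y), h₂⟩) ^ 2 = 0 := by linarith
  exact sub_eq_zero.1 (pow_eq_zero_iff (two_ne_zero)|>.1 this)

/-- The homomorphism `g ↦ g ∘ π_Y` into the multiplicative domain. -/
def pullbackHom (K : Compacts ((Fin n → ℝ) × (Fin m → ℝ))) :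
    C(projY K, ℝ) →ₐ[ℝ] (caffRep K).multAlg :=
  AlgHom.codRestrict (ContinuousMap.compRightAlgHom ℝ ℝ ⟨toProjY K, continuous_toProjY K⟩)
    (caffRep K).multAlg pullback_mem_multAlg

theorem pullbackHom_apply (g : C(projY K, ℝ)) (z : K) :
    (pullbackHom K g : C(K, ℝ)) z = g (toProjY K z) := rfl

/-- Multipliers are constant on the slices, and an open surjection is a quotient map, so they
descend to continuous functions on `Y`. -/
theorem pullbackHom_bijective
    (hK : IsRegularPartiallyConvex (K : Set ((Fin n → ℝ) × (Fin m → ℝ)))) :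
    Function.Bijective (pullbackHom K) := by
  constructor
  · intro g h hgh
    ext y
    obtain ⟨z, rfl⟩ := toProjY_surjective K y
    rw [← pullbackHom_apply, hgh, pullbackHom_apply]
  · intro g
    have hq : IsQuotientMap (toProjY K) :=
      (isOpenMap_toProjY hK).isQuotientMap (continuous_toProjY K) (toProjY_surjective K)
    choose s hs using toProjY_surjective K
    have hgs : ∀ z, (g : C(K, ℝ)) (s (toProjY K z)) = (g : C(K, ℝ)) z := fun z =>
      multAlg_apply_eq hK g (hs _)
    refine ⟨⟨fun y => (g : C(K, ℝ)) (s y), hq.continuous_iff.2 ?_⟩, ?_⟩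
    · exact (g : C(K, ℝ)).continuous.congr fun z => (hgs z).symm
    · ext z
      exact hgs z

/-- The identification of the multiplicative domain of `C_aff(K)` with `C(π_Y(K))`. -/
def multAlgEquiv (hK : IsRegularPartiallyConvex (K : Set ((Fin n → ℝ) × (Fin m → ℝ)))) :
    (caffRep K).multAlg ≃ₐ[ℝ] C(projY K, ℝ) :=
  (AlgEquiv.ofBijective (pullbackHom K) (pullbackHom_bijective hK)).symm

variable (hK : IsRegularPartiallyConvex (K : Set ((Fin n → ℝ) × (Fin m → ℝ))))

theorem multAlgEquiv_symm_apply (g : C(projY K, ℝ)) (z : K) :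
    ((multAlgEquiv hK).symm g : C(K, ℝ)) z = g (toProjY K z) := rfl

theorem multAlgEquiv_apply (g : (caffRep K).multAlg) (z : K) :
    multAlgEquiv hK g (toProjY K z) = (g : C(K, ℝ)) z := by
  rw [← multAlgEquiv_symm_apply hK, AlgEquiv.symm_apply_apply]

theorem caff_smul_apply (g : (caffRep K).multAlg) (f : caff K) (z : K) :
    ((g • f : caff K) : C(K, ℝ)) z = multAlgEquiv hK g (toProjY K z) * (f : C(K, ℝ)) z := by
  have := (caffRep K).ι_smul g f
  rw [multAlgEquiv_apply]
  exact congrArg (fun h : C(K, ℝ) => h z) this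

/-! ## The basis -/

/-- The functions `1, x₁, …, xₙ`. -/
def caffBasisFun (K : Compacts ((Fin n → ℝ) × (Fin m → ℝ))) : Fin (n + 1) → caff K :=
  Fin.cons (caffOne K) (caffCoord K)

theorem sum_smul_caffBasisFun_apply (g : Fin (n + 1) → (caffRep K).multAlg) (z : K) :
    ((∑ i, g i • caffBasisFun K i : caff K) : C(K, ℝ)) z
      = affEval (fun i => multAlgEquiv hK (g i) (toProjY K z)) z.1.1 := by
  rw [AddSubmonoidClass.coe_finsetSum, ContinuousMap.sum_apply, Fin.sum_univ_succ, affEval]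
  simp only [caff_smul_apply hK]
  simp [caffBasisFun, caffOne, caffCoord]

include hK in
theorem linearIndependent_caffBasisFun :
    LinearIndependent (caffRep K).multAlg (caffBasisFun K) := by
  refine Fintype.linearIndependent_iff.2 fun g hg i => ?_
  rw [← (multAlgEquiv hK).map_eq_zero_iff]
  ext y
  have : (fun i => multAlgEquiv hK (g i) y) = 0 := by
    refine eq_zero_of_affEval_eq_zero_of_slice hK y fun x hx => ?_
    have := sum_smul_caffBasisFun_apply hK g ⟨(x, y), hx⟩
    rw [hg] at this
    exact this.symm
  exact congrFun this i

/-- The continuous function `y ↦ c i y`. -/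
def coeffFun (c : C(projY K, Fin (n + 1) → ℝ)) (i : Fin (n + 1)) : C(projY K, ℝ) :=
  ⟨fun y => c y i, by fun_prop⟩

theorem sum_smul_eq_caffOfCoeff (c : C(projY K, Fin (n + 1) → ℝ)) :
    ∑ i, (multAlgEquiv hK).symm (coeffFun c i) • caffBasisFun K i = caffOfCoeff c := by
  ext z
  rw [sum_smul_caffBasisFun_apply hK]
  simp only [AlgEquiv.apply_symm_apply]
  rfl

include hK in
theorem exists_eq_caffOfCoeff (f : caff K) :
    ∃ c : C(projY K, Fin (n + 1) → ℝ), f = caffOfCoeff c := by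
  obtain ⟨c, hc⟩ := exists_coeff hK f
  exact ⟨c, Subtype.ext (ContinuousMap.ext hc)⟩

/-- The basis `1, x₁, …, xₙ` of `C_aff(K)` over its multiplicative domain. -/
def caffBasis : Module.Basis (Fin (n + 1)) (caffRep K).multAlg (caff K) :=
  Module.Basis.mk (linearIndependent_caffBasisFun hK) (by
    rintro f -
    obtain ⟨c, rfl⟩ := exists_eq_caffOfCoeff hK f
    rw [← sum_smul_eq_caffOfCoeff hK]
    exact Submodule.sum_mem _ fun i _ => Submodule.smul_mem _ _ (Submodule.subset_span ⟨i, rfl⟩))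

theorem caffBasis_apply (i : Fin (n + 1)) : caffBasis hK i = caffBasisFun K i :=
  Module.Basis.mk_apply _ _ i

theorem caff_apply_eq_affEval_repr (f : caff K) (z : K) :
    (f : C(K, ℝ)) z
      = affEval (fun i => multAlgEquiv hK ((caffBasis hK).repr f i) (toProjY K z)) z.1.1 := by
  rw [← sum_smul_caffBasisFun_apply hK]
  conv_lhs => rw [← (caffBasis hK).sum_repr f]
  simp only [caffBasis_apply]

end MultiplicativeDomain

/-! ## Order unit spaces of functions on compact spaces -/

namespace FunctionRep

variable {A : Type*} [AddCommGroup A] [Module ℝ A] {C : PointedCone ℝ A} {u : A}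
  {X : Type*} [TopologicalSpace X] [CompactSpace X]

theorem abs_apply_le (R : FunctionRep C u X) (a : A) (x : X) : |R.ι a x| ≤ ‖R.ι a‖ :=
  (R.ι a).norm_coe_le_norm x

theorem isAOUSpace (R : FunctionRep C u X) : IsAOUSpace C u where
  proper v hv hv' := by
    refine R.injective (ContinuousMap.ext fun x => ?_)
    have h1 := (R.mem_cone_iff v).1 hv x
    have h2 := (R.mem_cone_iff (-v)).1 hv' x
    rw [map_neg, ContinuousMap.neg_apply] at h2
    rw [map_zero, ContinuousMap.zero_apply]
    linarith
  order_unit v := by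
    refine ⟨‖R.ι v‖ + 1, by positivity, (R.mem_cone_iff _).2 fun x => ?_⟩
    have h := (abs_le.1 (R.abs_apply_le v x)).2
    simp only [map_sub, map_smul, R.map_unit, ContinuousMap.sub_apply, ContinuousMap.smul_apply,
      ContinuousMap.one_apply, smul_eq_mul, mul_one]
    linarith
  archimedean v hv := by
    refine (R.mem_cone_iff _).2 fun x => le_of_forall_pos_le_add fun ε hε => ?_
    have h := (R.mem_cone_iff _).1 (hv ε hε) x
    simp only [map_add, map_smul, R.map_unit, ContinuousMap.add_apply, ContinuousMap.smul_apply,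
      ContinuousMap.one_apply, smul_eq_mul, mul_one] at h
    linarith

/-- The order unit norm is the supremum norm. -/
theorem orderUnitNorm_eq (R : FunctionRep C u X) (v : A) : orderUnitNorm C u v = ‖R.ι v‖ := by
  have h : ∀ r : ℝ, 0 < r → (v + r • u ∈ C ∧ r • u - v ∈ C ↔ ‖R.ι v‖ ≤ r) := by
    intro r hr
    rw [ContinuousMap.norm_le _ hr.le, R.mem_cone_iff, R.mem_cone_iff, ← forall_and]
    refine forall_congr' fun x => ?_
    simp only [map_add, map_sub, map_smul, R.map_unit, ContinuousMap.add_apply,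
      ContinuousMap.sub_apply, ContinuousMap.smul_apply, ContinuousMap.one_apply, smul_eq_mul,
      mul_one, Real.norm_eq_abs, abs_le]
    constructor <;> rintro ⟨h1, h2⟩ <;> constructor <;> linarith
  refine IsGLB.csInf_eq ⟨fun r hr => (h r hr.1).1 hr.2, fun b hb => ?_⟩
    ⟨‖R.ι v‖ + 1, by positivity, (h _ (by positivity)).2 (by linarith)⟩
  -- The infimum runs over strictly positive `r`, so it is not attained when the norm is zero.
  refine le_of_forall_pos_le_add fun ε hε => ?_
  exact hb ⟨by positivity, (h _ (by positivity)).2 (by linarith)⟩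

end FunctionRep

/-! ### Fibers as spaces of affine functions on the slices -/

section Fibers

variable {n m : ℕ} {K : Compacts ((Fin n → ℝ) × (Fin m → ℝ))}

theorem caffRestrict_apply (y : projY K) (f : caff K)
    (x : slice (K : Set ((Fin n → ℝ) × (Fin m → ℝ))) y) :
    (caffRestrict K y f).1 x = (f : C(K, ℝ)) ⟨((x : Fin n → ℝ), y), x.2⟩ := rfl

theorem abs_caff_apply_le (f : caff K) (z : K) : |(f : C(K, ℝ)) z| ≤ ‖(f : C(K, ℝ))‖ :=
  (f : C(K, ℝ)).norm_coe_le_norm z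

variable (hK : IsRegularPartiallyConvex (K : Set ((Fin n → ℝ) × (Fin m → ℝ))))

/-- Pointwise `|g a| ≤ ‖a‖ |g|`, and the right side is itself a multiplier vanishing at `y`. -/
theorem caff_smul_mem_of_apply_eq_zero {y : projY K} {J : Submodule ℝ (caff K)}
    (hJ : IsOrderIdeal (caffCone K) J) (hy : (caffRep K).maxIdeal (multAlgEquiv hK) y ⊆ J)
    {g : (caffRep K).multAlg} (hg : multAlgEquiv hK g y = 0) (a : caff K) : g • a ∈ J := by
  set N : ℝ := ‖(a : C(K, ℝ))‖ with hN
  set h : (caffRep K).multAlg := (multAlgEquiv hK).symm (N • |multAlgEquiv hK g|) with hh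
  have hφ : multAlgEquiv hK h = N • |multAlgEquiv hK g| := AlgEquiv.apply_symm_apply _ _
  have hhJ : h • caffOne K ∈ J := hy ⟨h, by simp [hφ, hg], rfl⟩
  have hhz : ∀ z : K, ((h • caffOne K : caff K) : C(K, ℝ)) z
      = N * |multAlgEquiv hK g (toProjY K z)| := by
    intro z
    rw [caff_smul_apply hK, hφ]
    simp [caffOne]
  have hle : ∀ z : K, |((g • a : caff K) : C(K, ℝ)) z| ≤ ((h • caffOne K : caff K) : C(K, ℝ)) z := by
    intro z
    rw [hhz, caff_smul_apply hK, abs_mul, mul_comm]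
    exact mul_le_mul_of_nonneg_right (abs_caff_apply_le a z) (abs_nonneg _)
  -- Order ideals only test positive elements, so `g a` is shifted: `0 ≤ g a + h ≤ 2 h`.
  have hmem : g • a + h • caffOne K ∈ J := by
    refine hJ _ (h • caffOne K + h • caffOne K) (J.add_mem hhJ hhJ) ?_ ?_
    · intro z
      have := (abs_le.1 (hle z)).1
      change 0 ≤ ((g • a : caff K) : C(K, ℝ)) z + ((h • caffOne K : caff K) : C(K, ℝ)) z
      linarith
    · intro z
      have := (abs_le.1 (hle z)).2
      change 0 ≤ (((h • caffOne K : caff K) : C(K, ℝ)) z + ((h • caffOne K : caff K) : C(K, ℝ)) z)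
        - (((g • a : caff K) : C(K, ℝ)) z + ((h • caffOne K : caff K) : C(K, ℝ)) z)
      linarith
  simpa using J.sub_mem hmem hhJ

/-- The kernel is one of the competing closed order ideals. Conversely, if `f` vanishes on the
slice, its coefficients vanish at `y`, so each term `cᵢ eᵢ` lies in every competitor. -/
theorem fiberIdeal_eq_ker (y : projY K) :
    (caffRep K).fiberIdeal (multAlgEquiv hK) y = (caffRestrict K y).ker := by
  apply le_antisymm
  · refine sInf_le ⟨?_, ?_, ?_⟩
    · intro p q hq hp hqp
      refine Subtype.ext (ContinuousMap.ext fun x => le_antisymm ?_ (hp _))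
      have h1 : 0 ≤ (q : C(K, ℝ)) ⟨((x : Fin n → ℝ), y), x.2⟩
        - (p : C(K, ℝ)) ⟨((x : Fin n → ℝ), y), x.2⟩ := hqp _
      have h2 : (caffRestrict K y q).1 x = 0 := by rw [LinearMap.mem_ker.1 hq]; rfl
      rw [caffRestrict_apply] at h2
      change (p : C(K, ℝ)) ⟨((x : Fin n → ℝ), y), x.2⟩ ≤ 0
      linarith
    · intro v hv
      refine Subtype.ext (ContinuousMap.ext fun x => ?_)
      refine abs_eq_zero.1 (le_antisymm (le_of_forall_pos_le_add fun ε hε => ?_) (abs_nonneg _))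
      obtain ⟨w, hw, hvw⟩ := hv ε hε
      rw [(caffRep K).orderUnitNorm_eq] at hvw
      have h2 : (caffRestrict K y w).1 x = 0 := by rw [LinearMap.mem_ker.1 hw]; rfl
      have h3 : |(v : C(K, ℝ)) ⟨((x : Fin n → ℝ), y), x.2⟩
        - (w : C(K, ℝ)) ⟨((x : Fin n → ℝ), y), x.2⟩| ≤ _ :=
        (caffRep K).abs_apply_le (v - w) ⟨((x : Fin n → ℝ), y), x.2⟩
      rw [caffRestrict_apply] at h2
      rw [h2, sub_zero] at h3
      rw [zero_add]
      exact h3.trans hvw.le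
    · rintro _ ⟨g, hg, rfl⟩
      refine Subtype.ext (ContinuousMap.ext fun x => ?_)
      rw [caffRestrict_apply, caff_smul_apply hK]
      exact mul_eq_zero_of_left hg _
  · intro f hf
    refine Submodule.mem_sInf.2 fun J hJ => ?_
    rw [← (caffBasis hK).sum_repr f]
    refine Submodule.sum_mem _ fun i _ => caff_smul_mem_of_apply_eq_zero hK hJ.1 hJ.2.2 ?_ _
    refine congrFun (eq_zero_of_affEval_eq_zero_of_slice hK y
      (c := fun i => multAlgEquiv hK ((caffBasis hK).repr f i) y) fun x hx => ?_) i
    have h1 := caff_apply_eq_affEval_repr hK f ⟨(x, y), hx⟩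
    have h2 : (caffRestrict K y f).1 ⟨x, hx⟩ = 0 := by rw [LinearMap.mem_ker.1 hf]; rfl
    exact h1.symm.trans h2

/-- The element `c₀ + ∑ cᵢ xᵢ` of `C_aff(K)` with constant coefficients. -/
def caffOfConst (K : Compacts ((Fin n → ℝ) × (Fin m → ℝ))) :
    (Fin (n + 1) → ℝ) →ₗ[ℝ] caff K where
  toFun c := caffOfCoeff (ContinuousMap.const _ c)
  map_add' c d := Subtype.ext (ContinuousMap.ext fun z => affEval_add c d z.1.1)
  map_smul' a c := Subtype.ext (ContinuousMap.ext fun z => affEval_smul a c z.1.1)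

-- This yields the dimension `n + 1` and, in every fiber, representatives with constant
-- coefficients, which can be compared across different `y`.
include hK in
theorem caffRestrict_caffOfConst_bijective (y : projY K) :
    Function.Bijective (caffRestrict K y ∘ₗ caffOfConst K) := by
  constructor
  · refine (injective_iff_map_eq_zero _).2 fun c hc => ?_
    refine eq_zero_of_affEval_eq_zero_of_slice hK y fun x hx => ?_
    have h : ((caffRestrict K y ∘ₗ caffOfConst K) c).1 ⟨x, hx⟩ = 0 := by rw [hc]; rfl
    exact h
  · intro f
    obtain ⟨p, r, hr, hb⟩ := exists_box_subset_slice hK y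
    obtain ⟨c, hc⟩ := exists_affEval_of_mem_affFunctions (convex_slice hK y) hr hb f.2
    exact ⟨c, Subtype.ext (ContinuousMap.ext fun x => (hc x).symm)⟩

include hK in
theorem caffRestrict_surjective (y : projY K) : Function.Surjective (caffRestrict K y) := by
  intro f
  obtain ⟨c, hc⟩ := (caffRestrict_caffOfConst_bijective hK y).2 f
  exact ⟨_, hc⟩

/-- Restriction to the slice, as an isomorphism of the fiber with `Aff(K_y)`. -/
def fiberEquiv (y : projY K) : (caffRep K).Fiber (multAlgEquiv hK) y ≃ₗ[ℝ]
    affFunctions (slice (K : Set ((Fin n → ℝ) × (Fin m → ℝ))) y) :=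
  (Submodule.quotEquivOfEq _ _ (fiberIdeal_eq_ker hK y)).trans
    ((caffRestrict K y).quotKerEquivOfSurjective (caffRestrict_surjective hK y))

theorem fiberEquiv_toFiber (y : projY K) (f : caff K) :
    fiberEquiv hK y ((caffRep K).toFiber (multAlgEquiv hK) y f) = caffRestrict K y f := rfl

theorem toFiber_surjective (y : projY K) :
    Function.Surjective ((caffRep K).toFiber (multAlgEquiv hK) y) :=
  Submodule.mkQ_surjective _

theorem toFiber_eq_iff (y : projY K) (f g : caff K) :
    (caffRep K).toFiber (multAlgEquiv hK) y f = (caffRep K).toFiber (multAlgEquiv hK) y g ↔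
      ∀ z : K, toProjY K z = y → (f : C(K, ℝ)) z = (g : C(K, ℝ)) z := by
  rw [← (fiberEquiv hK y).injective.eq_iff, fiberEquiv_toFiber, fiberEquiv_toFiber]
  constructor
  · rintro h ⟨⟨x, _⟩, hz⟩ rfl
    exact congrArg (fun f => f.1 ⟨x, hz⟩) h
  · exact fun h => Subtype.ext (ContinuousMap.ext fun x => h ⟨((x : Fin n → ℝ), y), x.2⟩ rfl)

include hK in
/-- A function that is nonnegative on one slice agrees there with a nonnegative function. -/
theorem exists_nonneg_of_slice_nonneg (y : projY K) (f : caff K)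
    (hf : ∀ z : K, toProjY K z = y → 0 ≤ (f : C(K, ℝ)) z) :
    ∃ F ∈ caffCone K, ∀ z : K, toProjY K z = y → (F : C(K, ℝ)) z = (f : C(K, ℝ)) z := by
  -- The correction `g` is the maximum over each slice of the negative part of `f`.
  obtain ⟨g, hg⟩ := exists_continuousMap_isGreatest_fiber (continuous_toProjY K)
    (isOpenMap_toProjY hK) (toProjY_surjective K) (-(f : C(K, ℝ)) ⊔ 0)
  refine ⟨f + pullback g, fun z => ?_, ?_⟩
  · have h := (hg (toProjY K z)).2 ⟨z, rfl, rfl⟩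
    have h' : -(f : C(K, ℝ)) z ≤ max (-(f : C(K, ℝ)) z) 0 := le_max_left _ _
    change 0 ≤ (f : C(K, ℝ)) z + g (toProjY K z)
    have h2 : max (-(f : C(K, ℝ)) z) 0 ≤ g (toProjY K z) := h
    linarith
  · rintro z rfl
    obtain ⟨w, hw, hgw⟩ := (hg (toProjY K z)).1
    have h0 : g (toProjY K z) = 0 := by
      rw [← hgw]
      exact max_eq_right (neg_nonpos.2 (hf w hw))
    change (f : C(K, ℝ)) z + g (toProjY K z) = _
    rw [h0, add_zero]

theorem toFiber_mem_fiberCone_iff (y : projY K) (f : caff K) :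
    (caffRep K).toFiber (multAlgEquiv hK) y f ∈ (caffRep K).fiberCone (multAlgEquiv hK) y ↔
      ∀ z : K, toProjY K z = y → 0 ≤ (f : C(K, ℝ)) z := by
  constructor
  · rintro ⟨F, hF, h⟩ z hz
    rw [← (toFiber_eq_iff hK y F f).1 h z hz]
    exact hF z
  · intro hf
    obtain ⟨F, hF, h⟩ := exists_nonneg_of_slice_nonneg hK y f hf
    exact ⟨F, hF, (toFiber_eq_iff hK y F f).2 h⟩

theorem mem_fiberCone_iff (y : projY K) (v : (caffRep K).Fiber (multAlgEquiv hK) y) :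
    v ∈ (caffRep K).fiberCone (multAlgEquiv hK) y ↔ ∀ x, 0 ≤ (fiberEquiv hK y v).1 x := by
  obtain ⟨f, rfl⟩ := toFiber_surjective hK y v
  rw [toFiber_mem_fiberCone_iff, fiberEquiv_toFiber]
  constructor
  · exact fun h x => h _ rfl
  · rintro h ⟨⟨x, _⟩, hz⟩ rfl
    exact h ⟨x, hz⟩

/-- The fiber, represented by functions on the slice. -/
def fiberRep (y : projY K) : FunctionRep ((caffRep K).fiberCone (multAlgEquiv hK) y)
    ((caffRep K).toFiber (multAlgEquiv hK) y (caffOne K))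
    (slice (K : Set ((Fin n → ℝ) × (Fin m → ℝ))) y) where
  ι := (Submodule.subtype _) ∘ₗ (fiberEquiv hK y).toLinearMap
  injective := Subtype.val_injective.comp (fiberEquiv hK y).injective
  map_unit := rfl
  mem_cone_iff := mem_fiberCone_iff hK y

theorem fiberNorm_toFiber_le_iff (y : projY K) (f : caff K) {r : ℝ} (hr : 0 ≤ r) :
    (caffRep K).fiberNorm (multAlgEquiv hK) y ((caffRep K).toFiber (multAlgEquiv hK) y f) ≤ r ↔
      ∀ z : K, toProjY K z = y → |(f : C(K, ℝ)) z| ≤ r := by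
  rw [FunctionRep.fiberNorm, (fiberRep hK y).orderUnitNorm_eq, ContinuousMap.norm_le _ hr]
  constructor
  · rintro h ⟨⟨x, _⟩, hz⟩ rfl
    exact h ⟨x, hz⟩
  · exact fun h x => h ⟨((x : Fin n → ℝ), y), x.2⟩ rfl

theorem fiberNorm_nonneg (y : projY K) (v : (caffRep K).Fiber (multAlgEquiv hK) y) :
    0 ≤ (caffRep K).fiberNorm (multAlgEquiv hK) y v :=
  Real.sInf_nonneg fun _ hr => hr.1.le

theorem finrank_fiber (y : projY K) :
    Module.finrank ℝ ((caffRep K).Fiber (multAlgEquiv hK) y) = n + 1 := by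
  rw [(fiberEquiv hK y).finrank_eq,
    ← (LinearEquiv.ofBijective _ (caffRestrict_caffOfConst_bijective hK y)).finrank_eq]
  simp

end Fibers

/-! ## The free order unit module `C_aff(K)` -/

section Main

variable {n m : ℕ} {K : Compacts ((Fin n → ℝ) × (Fin m → ℝ))}

theorem exists_norm_fst_le (K : Compacts ((Fin n → ℝ) × (Fin m → ℝ))) :
    ∃ D : ℝ, 0 ≤ D ∧ ∀ z : K, ‖z.1.1‖ ≤ D := by
  obtain ⟨D, hD⟩ := (K.isCompact.image continuous_fst).isBounded.exists_norm_le
  exact ⟨|D|, abs_nonneg D, fun z => (hD _ ⟨z.1, z.2, rfl⟩).trans (le_abs_self D)⟩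

variable (hK : IsRegularPartiallyConvex (K : Set ((Fin n → ℝ) × (Fin m → ℝ))))

/-- A positive class lifts to some `a ∈ A⁺`, whose classes form a positive section through it. -/
theorem fiberLHC_fiberCone : (caffRep K).FiberLHC (multAlgEquiv hK)
    (fun y => {v | v ∈ (caffRep K).fiberCone (multAlgEquiv hK) y}) := by
  rintro y y₀ - _ ⟨a, ha, rfl⟩
  refine ⟨fun k => (caffRep K).toFiber (multAlgEquiv hK) (y k) a, fun k => ⟨a, ha, rfl⟩, a, rfl, ?_⟩
  refine tendsto_const_nhds.congr fun k => ?_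
  rw [sub_self, FunctionRep.fiberNorm, (fiberRep hK (y k)).orderUnitNorm_eq, map_zero, norm_zero]

include hK in
/-- Closed conditions on the values on slices pass to the limit. -/
theorem affEval_mem_of_tendsto {y : ℕ → projY K} {y₀ : projY K} (hy : Tendsto y atTop (𝓝 y₀))
    {c : ℕ → Fin (n + 1) → ℝ} {c₀ : Fin (n + 1) → ℝ} (hc : Tendsto c atTop (𝓝 c₀)) {T : Set ℝ}
    (hT : IsClosed T) (h : ∀ k, ∀ z : K, toProjY K z = y k → affEval (c k) z.1.1 ∈ T)
    (z : K) (hz : toProjY K z = y₀) : affEval c₀ z.1.1 ∈ T := by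
  by_contra hzT
  have hcont : Continuous fun p : (Fin (n + 1) → ℝ) × K => affEval p.1 p.2.1.1 := by
    unfold affEval
    fun_prop
  have hev : ∀ᶠ p in 𝓝 (c₀, z), affEval p.1 p.2.1.1 ∈ Tᶜ :=
    hcont.continuousAt.eventually (hT.isOpen_compl.mem_nhds hzT)
  rw [nhds_prod_eq] at hev
  obtain ⟨U, hU, V, hV, hUV⟩ := eventually_prod_iff.1 hev
  -- By openness of the projection, slices over points near `y₀` contain points near `z`, where the
  -- closed condition would fail too.
  have hVy : ∀ᶠ y in 𝓝 y₀, y ∈ toProjY K '' {w | V w} := by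
    rw [← hz]
    exact (isOpenMap_toProjY hK).image_mem_nhds hV
  obtain ⟨k, hkc, w, hw, hwk⟩ := ((hc.eventually hU).and (hy.eventually hVy)).exists
  exact hUV hkc hw (h k w hwk)

theorem exists_toFiber_caffOfConst_eq (y : projY K)
    (v : (caffRep K).Fiber (multAlgEquiv hK) y) :
    ∃ c, (caffRep K).toFiber (multAlgEquiv hK) y (caffOfConst K c) = v := by
  obtain ⟨c, hc⟩ := (caffRestrict_caffOfConst_bijective hK y).2 (fiberEquiv hK y v)
  exact ⟨c, (fiberEquiv hK y).injective hc⟩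

/-- With constant-coefficient representatives, the uniform coefficient bound confines all
coefficient vectors to one ball of `ℝⁿ⁺¹`. Bolzano–Weierstrass gives a limit, and positivity and the
norm bound are closed conditions on slice values. -/
theorem fiberUHC_fiberCone {r : ℝ} (hr : 0 < r) : (caffRep K).FiberUHC (multAlgEquiv hK)
    (fun y => {v | v ∈ (caffRep K).fiberCone (multAlgEquiv hK) y ∧
      (caffRep K).fiberNorm (multAlgEquiv hK) y v ≤ r}) := by
  intro y y₀ hy v hv
  choose c hc using fun k => exists_toFiber_caffOfConst_eq hK (y k) (v k)
  obtain rfl : (fun k => (caffRep K).toFiber (multAlgEquiv hK) (y k) (caffOfConst K (c k))) = v :=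
    funext hc
  have hpos : ∀ k, ∀ z : K, toProjY K z = y k → 0 ≤ affEval (c k) z.1.1 := fun k =>
    (toFiber_mem_fiberCone_iff hK _ _).1 (hv k).1
  have hle : ∀ k, ∀ z : K, toProjY K z = y k → |affEval (c k) z.1.1| ≤ r := fun k =>
    (fiberNorm_toFiber_le_iff hK _ _ hr.le).1 (hv k).2
  obtain ⟨M, hM⟩ := exists_coeff_bound hK
  have hbd : ∀ k, c k ∈ Metric.closedBall (0 : Fin (n + 1) → ℝ) |M * r| := by
    intro k
    rw [mem_closedBall_zero_iff, pi_norm_le_iff_of_nonneg (abs_nonneg _)]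
    exact fun i => (hM (y k) (c k) r (fun x hx => hle k ⟨(x, y k), hx⟩ rfl) i).trans
      (le_abs_self _)
  obtain ⟨c₀, -, s, hs, hcs⟩ := tendsto_subseq_of_bounded Metric.isBounded_closedBall hbd
  have hys : Tendsto (fun k => y (s k)) atTop (𝓝 y₀) := hy.comp hs.tendsto_atTop
  refine ⟨(caffRep K).toFiber (multAlgEquiv hK) y₀ (caffOfConst K c₀), ⟨?_, ?_⟩, s, hs,
    caffOfConst K c₀, rfl, ?_⟩
  · rw [toFiber_mem_fiberCone_iff]
    exact affEval_mem_of_tendsto hK hys hcs isClosed_Ici fun k => hpos (s k)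
  · rw [fiberNorm_toFiber_le_iff hK _ _ hr.le]
    exact affEval_mem_of_tendsto hK hys hcs
      (isClosed_le continuous_abs continuous_const : IsClosed {t : ℝ | |t| ≤ r}) fun k => hle (s k)
  · obtain ⟨D, hD0, hD⟩ := exists_norm_fst_le K
    have hlim : Tendsto (fun k => (∑ i, |(c (s k) - c₀) i|) * (1 + D)) atTop (𝓝 0) := by
      have h1 : Tendsto (fun k => c (s k) - c₀) atTop (𝓝 0) := by
        simpa using hcs.sub_const c₀
      have h2 : Continuous fun d : Fin (n + 1) → ℝ => (∑ i, |d i|) * (1 + D) := by fun_prop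
      have h3 := (h2.tendsto 0).comp h1
      simp only [Pi.zero_apply, abs_zero, Finset.sum_const_zero, zero_mul] at h3
      exact h3
    refine squeeze_zero (fun k => fiberNorm_nonneg hK _ _) (fun k => ?_) hlim
    have h0 : 0 ≤ ∑ i, |(c (s k) - c₀) i| := Finset.sum_nonneg fun i _ => abs_nonneg _
    rw [← map_sub, ← map_sub, fiberNorm_toFiber_le_iff hK _ _ (by positivity)]
    intro z _
    refine (abs_affEval_le _ _).trans (mul_le_mul_of_nonneg_left ?_ h0)
    linarith [hD z]

/-- The coefficients are bounded by the supremum norm. -/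
theorem exists_norm_repr_le : ∃ M : ℝ, ∀ (f : caff K) (i : Fin (n + 1)),
    ‖multAlgEquiv hK ((caffBasis hK).repr f i)‖ ≤ M * ‖(f : C(K, ℝ))‖ := by
  obtain ⟨M, hM⟩ := exists_coeff_bound hK
  refine ⟨|M|, fun f i => (ContinuousMap.norm_le _ (by positivity)).2 fun y => ?_⟩
  refine (hM y (fun i => multAlgEquiv hK ((caffBasis hK).repr f i) y) ‖(f : C(K, ℝ))‖
    (fun x hx => ?_) i).trans (mul_le_mul_of_nonneg_right (le_abs_self M) (norm_nonneg _))
  have h := caff_apply_eq_affEval_repr hK f ⟨(x, y), hx⟩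
  exact (congrArg abs h).symm.trans_le (abs_caff_apply_le f _)

/-- The supremum norm is bounded by the norms of the coefficients. -/
theorem exists_norm_le_sum_norm_repr : ∃ M : ℝ, ∀ f : caff K,
    ‖(f : C(K, ℝ))‖ ≤ (∑ i, ‖multAlgEquiv hK ((caffBasis hK).repr f i)‖) * M := by
  obtain ⟨D, hD0, hD⟩ := exists_norm_fst_le K
  refine ⟨1 + D, fun f => ?_⟩
  have h0 : 0 ≤ ∑ i, ‖multAlgEquiv hK ((caffBasis hK).repr f i)‖ :=
    Finset.sum_nonneg fun i _ => norm_nonneg _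
  refine (ContinuousMap.norm_le _ (by positivity)).2 fun z => ?_
  rw [caff_apply_eq_affEval_repr hK f z]
  refine (abs_affEval_le _ _).trans (mul_le_mul (Finset.sum_le_sum fun i _ => ?_)
    (by linarith [hD z]) (by positivity) h0)
  exact (multAlgEquiv hK ((caffBasis hK).repr f i)).norm_coe_le_norm (toProjY K z)

/-- The two preceding estimates bound the linear map `Ψ` and its inverse. -/
theorem tendsto_iff_tendsto_repr (a : ℕ → caff K) (a₀ : caff K) :
    Tendsto (fun k => orderUnitNorm (caffCone K) (caffOne K) (a k - a₀)) atTop (𝓝 0) ↔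
      ∀ i, Tendsto (fun k => ‖multAlgEquiv hK ((caffBasis hK).repr (a k) i)
        - multAlgEquiv hK ((caffBasis hK).repr a₀ i)‖) atTop (𝓝 0) := by
  have e : ∀ k i, multAlgEquiv hK ((caffBasis hK).repr (a k) i)
      - multAlgEquiv hK ((caffBasis hK).repr a₀ i)
      = multAlgEquiv hK ((caffBasis hK).repr (a k - a₀) i) := by
    intro k i
    rw [map_sub, Finsupp.sub_apply, map_sub]
  simp only [e, (caffRep K).orderUnitNorm_eq]
  constructor
  · intro h i
    obtain ⟨M, hM⟩ := exists_norm_repr_le hK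
    refine squeeze_zero (fun k => norm_nonneg _) (fun k => hM (a k - a₀) i) ?_
    have h1 := h.const_mul M
    rw [mul_zero] at h1
    exact h1
  · intro h
    obtain ⟨M, hM⟩ := exists_norm_le_sum_norm_repr hK
    refine squeeze_zero (fun k => norm_nonneg _) (fun k => hM (a k - a₀)) ?_
    simpa using (tendsto_finsetSum Finset.univ fun i _ => h i).mul_const M

theorem norm_multAlgEquiv (g : (caffRep K).multAlg) :
    ‖multAlgEquiv hK g‖ = orderUnitNorm (caffCone K) (caffOne K) (g • caffOne K) := by
  rw [(caffRep K).orderUnitNorm_eq]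
  have h : ∀ z : K, ((g • caffOne K : caff K) : C(K, ℝ)) z = multAlgEquiv hK g (toProjY K z) := by
    intro z
    rw [caff_smul_apply hK]
    exact mul_one _
  apply le_antisymm
  · refine (ContinuousMap.norm_le _ (norm_nonneg _)).2 fun y => ?_
    obtain ⟨z, rfl⟩ := toProjY_surjective K y
    rw [← h]
    exact abs_caff_apply_le _ z
  · refine (ContinuousMap.norm_le _ (norm_nonneg _)).2 fun z => ?_
    exact (congrArg norm (h z)).trans_le (ContinuousMap.norm_coe_le_norm _ _)

-- Stone–Weierstrass: the `m` coordinate functions separate the points of `Y ⊆ ℝᵐ`.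
include hK in
theorem exists_finite_dense_adjoin : ∃ S : Set (caffRep K).multAlg, S.Finite ∧
    ∀ (g : (caffRep K).multAlg) (ε : ℝ), 0 < ε → ∃ h ∈ Algebra.adjoin ℝ S,
      orderUnitNorm (caffCone K) (caffOne K) ((g - h) • caffOne K) < ε := by
  set coord : Fin m → C(projY K, ℝ) := fun i => ⟨fun y => (y : Fin m → ℝ) i,
    (continuous_apply i).comp continuous_subtype_val⟩
  refine ⟨(multAlgEquiv hK).symm '' range coord, (finite_range coord).image _, fun g ε hε => ?_⟩
  have hsep : (Algebra.adjoin ℝ (range coord)).SeparatesPoints := by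
    intro y y' hyy
    obtain ⟨i, hi⟩ := Function.ne_iff.1 (Subtype.coe_injective.ne hyy)
    exact ⟨coord i, ⟨coord i, Algebra.subset_adjoin ⟨i, rfl⟩, rfl⟩, hi⟩
  obtain ⟨⟨h, hh⟩, hgh⟩ :=
    ContinuousMap.exists_mem_subalgebra_near_continuousMap_of_separatesPoints _ hsep
      (multAlgEquiv hK g) ε hε
  refine ⟨(multAlgEquiv hK).symm h, ?_, ?_⟩
  · have : Algebra.adjoin ℝ ((multAlgEquiv hK).symm '' range coord)
        = (Algebra.adjoin ℝ (range coord)).map (multAlgEquiv hK).symm.toAlgHom :=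
      (AlgHom.map_adjoin _ _).symm
    rw [this]
    exact ⟨h, hh, rfl⟩
  · rwa [← norm_multAlgEquiv hK, map_sub, AlgEquiv.apply_symm_apply, norm_sub_rev]

theorem isFreeOrderUnitModule_caff :
    IsFreeOrderUnitModule (caffRep K) (projY K) (multAlgEquiv hK) (caffBasis hK) where
  compact := inferInstance
  t2 := inferInstance
  aou := (caffRep K).isAOUSpace
  isometric := norm_multAlgEquiv hK
  finitely_generated := exists_finite_dense_adjoin hK
  one_act a := by rw [map_one, one_smul]
  unit_aligned := by
    rw [map_one, one_smul, caffBasis_apply]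
    rfl
  fiber_dim := finrank_fiber hK
  fiber_aou y := (fiberRep hK y).isAOUSpace
  cone_iff a := by
    simp only [toFiber_mem_fiberCone_iff]
    exact ⟨fun h y z _ => h z, fun h z => h _ z rfl⟩
  lhc := fiberLHC_fiberCone hK
  uhc _ hr := fiberUHC_fiberCone hK hr
  topological := tendsto_iff_tendsto_repr hK

end Main

end

theorem mainTheorem5 (n m : ℕ) (K : Compacts ((Fin n → ℝ) × (Fin m → ℝ)))
    (hK : IsRegularPartiallyConvex (K : Set ((Fin n → ℝ) × (Fin m → ℝ)))) :
    -- the order unit norm of `C_aff(K)` is the supremum norm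
    (∀ f : caff K, orderUnitNorm (caffCone K) (caffOne K) f = ‖(f : C(K, ℝ))‖) ∧
    ∃ (φ : (caffRep K).multAlg ≃ₐ[ℝ] C(projY K, ℝ))
      (e : Module.Basis (Fin (n + 1)) (caffRep K).multAlg (caff K)),
      -- `C_aff(K)` is a free order unit module of type `(n, m)` over `C(π_Y(K))`
      IsFreeOrderUnitModule (caffRep K) (projY K) φ e ∧
      -- the multiplicative domain is `C(π_Y(K))`, embedded as the functions constant in `x`
      (∀ (g : C(projY K, ℝ)) (z : K), (φ.symm g : C(K, ℝ)) z = g (toProjY K z)) ∧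
      -- the basis is `1, x₁, …, xₙ`
      e 0 = caffOne K ∧ (∀ i : Fin n, e i.succ = caffCoord K i) ∧
      -- restriction to the slice induces a unital order isomorphism of the fiber with `Aff(K_y)`
      ∀ y : projY K,
        ∃ ψ : (caffRep K).Fiber φ y ≃ₗ[ℝ]
            affFunctions (slice (K : Set ((Fin n → ℝ) × (Fin m → ℝ))) y),
          (∀ f : caff K, ψ ((caffRep K).toFiber φ y f) = caffRestrict K y f) ∧
          (∀ x, (ψ ((caffRep K).toFiber φ y (caffOne K))).1 x = 1) ∧
          ∀ v : (caffRep K).Fiber φ y, v ∈ (caffRep K).fiberCone φ y ↔ ∀ x, 0 ≤ (ψ v).1 x := by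
  refine ⟨(caffRep K).orderUnitNorm_eq, multAlgEquiv hK, caffBasis hK,
    isFreeOrderUnitModule_caff hK, multAlgEquiv_symm_apply hK, ?_, fun i => ?_, fun y =>
    ⟨fiberEquiv hK y, fiberEquiv_toFiber hK y, fun _ => rfl, mem_fiberCone_iff hK y⟩⟩
  · exact caffBasis_apply hK 0
  · exact caffBasis_apply hK i.succ
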